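/- Consider finite unweighted loopless multigraphs in the deterministic $\mathsf{CONGEST}$ model: in each synchronous round every vertex sends a message of $O(\log n)$ bits to each of its neighbours, where $n$ is the number of vertices; the vertices have distinct identifiers of $O(\log n)$ bits; initially every vertex knows $n$, its own identifier and its incident edges (an edge being named by the identifiers of its endpoints and an index among parallel edges); local computation is unrestricted. An edge cut (vertex cut) is a set of edges (vertices) whose removal disconnects the graph, and a minimum cut is one of smallest size. Let $k$ be a constant. (1) There is a deterministic $\mathsf{CONGEST}$ algorithm that on every connected multigraph $G$, of diameter $D$ (not known to the vertices), finishes within $\mathsf{poly}(D)$ rounds, where the polynomial depends only on $k$. If $G$ has an edge cut of size at most $k$, then all vertices output one and the same minimum edge cut of $G$, and moreover each vertex outputs a (possibly empty) list of minimum edge cuts such that every minimum edge cut of $G$ is listed by at least one vertex. If $G$ has no edge cut of size at most $k$, then all vertices report this. (2) The same holds for vertex cuts in place of edge cuts, within $\mathsf{poly}(D\cdot\Delta)$ rounds, where $\Delta$ is the maximum number of neighbours of a vertex of $G$ (not known to the vertices either). -/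

import Mathlib

/-- A finite loopless multigraph whose vertices are natural numbers; every vertex is identified
with its own identifier. `mult u v` is the number of parallel edges joining `u` and `v`. -/
structure Network where
  verts : Finset ℕ
  mult : ℕ → ℕ → ℕ
  mult_comm : ∀ u v, mult u v = mult v u
  mult_self : ∀ v, mult v v = 0
  mem_of_mult : ∀ u v, mult u v ≠ 0 → u ∈ verts

/-- The name of an edge: its two endpoints and its index among the edges parallel to it. -/
abbrev EdgeName : Type := Sym2 ℕ × ℕ

namespace Network

/-- The number `n` of vertices. -/
def size (G : Network) : ℕ := G.verts.card

/-- `e` is an edge of `G`; the edges joining `u` and `v` are `(s(u, v), i)` for `i < mult u v`. -/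
def IsEdge (G : Network) (e : EdgeName) : Prop :=
  ∃ u v, e.1 = s(u, v) ∧ e.2 < G.mult u v

/-- Adjacency in `G` after the edges in `F` have been removed. -/
def deleteEdges (G : Network) (F : Finset EdgeName) : SimpleGraph G.verts where
  Adj u v := ∃ i, i < G.mult u v ∧ (s((u : ℕ), (v : ℕ)), i) ∉ F
  symm := ⟨by
    rintro u v ⟨i, hi, hF⟩
    exact ⟨i, by rwa [G.mult_comm], by rwa [Sym2.eq_swap]⟩⟩
  loopless := ⟨by
    rintro v ⟨i, hi, -⟩
    simp [G.mult_self] at hi⟩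

/-- The underlying simple graph (adjacency) of `G`. -/
def graph (G : Network) : SimpleGraph G.verts := G.deleteEdges ∅

/-- The diameter `D`. -/
noncomputable def diam (G : Network) : ℕ := G.graph.diam

/-- The maximum degree `Δ`: the largest number of neighbours of a vertex. -/
noncomputable def maxDegree (G : Network) : ℕ :=
  letI : DecidableRel G.graph.Adj := Classical.decRel _
  G.graph.maxDegree

/-- A set of edges whose removal disconnects `G`. -/
def IsEdgeCut (G : Network) (F : Finset EdgeName) : Prop :=
  (∀ e ∈ F, G.IsEdge e) ∧ ¬ (G.deleteEdges F).Preconnected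

/-- A set of vertices whose removal leaves two vertices that are not joined by a path. -/
def IsVertexCut (G : Network) (S : Finset ℕ) : Prop :=
  S ⊆ G.verts ∧ ¬ (G.graph.induce {v : G.verts | (v : ℕ) ∉ S}).Preconnected

end Network

/-- The deterministic program run by every node in a synchronous message passing network, with
message alphabet `M` and output type `O`. Local computation is unrestricted.
* `init x t` is the initial state of the node with identifier `x` that is joined to the node with
  identifier `y` by `t y` edges (for every `y`);
* `send s y` is the message that a node in state `s` sends to its neighbour `y`;
* `step s inbox` is the next state, where `inbox y` is the message that came from neighbour `y`
  (`none` if `y` is not a neighbour);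
* `output s` is the output of the node, `none` as long as it has not decided. An output is
  irrevocable. -/
structure NodeProgram (M O : Type) where
  State : Type
  init : ℕ → (ℕ → ℕ) → State
  send : State → ℕ → M
  step : State → (ℕ → Option M) → State
  output : State → Option O
  output_step : ∀ s inbox o, output s = some o → output (step s inbox) = some o

/-- The state of each node of `G` after a given number of rounds. -/
def NodeProgram.run {M O : Type} (A : NodeProgram M O) (G : Network) : ℕ → ℕ → A.State
  | 0, v => A.init v (G.mult v)
  | r + 1, v => A.step (A.run G r v)
      (fun u => if G.mult u v = 0 then none else some (A.send (A.run G r u) v))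

/-- After `T` rounds on `G` every node has produced its output, and `out v` is that of `v`. -/
def NodeProgram.Outputs {M O : Type} (A : NodeProgram M O) (G : Network) (T : ℕ) (out : ℕ → O) :
    Prop :=
  ∀ v ∈ G.verts, A.output (A.run G T v) = some (out v)

/-- Deterministic `CONGEST` algorithms with bandwidth `c * (⌊log₂ n⌋ + 1)` bits per message. The
nodes know the number `n` of vertices: the program may depend on it. -/
abbrev CongestAlgorithm (c : ℕ) (O : Type) : Type 1 :=
  ∀ n : ℕ, NodeProgram (BitVec (c * (Nat.log 2 n + 1))) O

/-- What a node outputs: a cut agreed on by all nodes (`none` stands for the answer that there is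
no cut of the size in question) and the set of all minimum cuts that this node knows. -/
structure CutOutput (α : Type) where
  chosen : Option (Finset α)
  known : Finset (Finset α)

/-- A cut of smallest cardinality, with respect to a given notion of cut. -/
def IsMinimumCut {α : Type} (IsCut : Finset α → Prop) (F : Finset α) : Prop :=
  IsCut F ∧ ∀ F', IsCut F' → F.card ≤ F'.card

/-- The outputs of the nodes `verts` solve the minimum cut problem up to cut size `k`. -/
structure SolvesMinCut {α : Type} (k : ℕ) (verts : Finset ℕ) (IsCut : Finset α → Prop)
    (out : ℕ → CutOutput α) : Prop where
  /-- If there is a cut of size at most `k`, then all nodes output the same minimum cut. -/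
  chosen_of_cut : (∃ F, IsCut F ∧ F.card ≤ k) →
    ∃ F, IsMinimumCut IsCut F ∧ ∀ v ∈ verts, (out v).chosen = some F
  /-- Otherwise all nodes report that there is no such cut. -/
  chosen_of_no_cut : (¬ ∃ F, IsCut F ∧ F.card ≤ k) → ∀ v ∈ verts, (out v).chosen = none
  /-- Only minimum cuts are listed. -/
  known_sound : ∀ v ∈ verts, ∀ F ∈ (out v).known, IsMinimumCut IsCut F
  /-- Every minimum cut of size at most `k` is known to at least one node. -/
  known_complete : ∀ F, IsMinimumCut IsCut F → F.card ≤ k → ∃ v ∈ verts, F ∈ (out v).known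

/-!
# Small minimum cuts in the `CONGEST` model

Fix a source `s`. To find out which sets `F` of at most `k` edges separate it from a vertex `v`, it
suffices to know, for sufficiently many edge sets `Z`, whether `v` is reachable from `s` in `G ∖ Z`:
if the sets `Z` are such that for every `F` and every path `P` of length at most `L` that avoids `F`
some `Z` contains `F` and misses `P`, then `F` separates `v` from `s` if and only if `v` is not
reached within distance `L` in any `G ∖ Z` with `F ⊆ Z`. Here `L` has to bound the distances in
`G ∖ F`, and `(2 k + 1) (2 D + 1)` will do: a path of `G` from any vertex to `s` leads, before it
uses an edge of `F`, to `s` or an end of an edge of `F`, and vertices of a shortest path in `G ∖ F`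
that lead to the same such vertex are at distance at most `2 D` (`CutModel.reachIn_of_reachIn`).

By the probabilistic method, a family of `poly(L) * log n` sets `Z` exists for all `F` and `P`
at once (`exists_grouped_family`). It is agreed on beforehand. A search in `G ∖ Z` sends one bit
over each edge and round, so that `Θ(log n)` searches can be run in parallel, and the number of
rounds does not depend on `n` (`Network.runs_search`). Each vertex then lists, without further
communication, all sets `F` of possible names of edges that separate it from `s`. A smallest such
set consists of actual edges, and is a minimum cut of `G`; conversely every minimum cut separates
some vertex from `s` (`solvesMinCut_of_local`). The size of a minimum cut, and then one of the
minimum cuts, are agreed on by flooding.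

Vertex cuts are treated in the same way, with `k + 1` sources, as a source may lie in the cut,
and with `k Δ + 1` in place of `2 k + 1`, since the deletion of `F` affects up to `k Δ` vertices.
Both cases are instances of a `CutModel`.

The diameter is not known, but the nodes can find a `d ≤ D` with `D ≤ 2 d`: flood the smallest
identifier for `d = 0, 1, …` rounds, until it has reached everybody. If it has not, then
every node sees within distance `2 d + 1` that the results of the flooding differ, so that all nodes
agree on whether to continue (`Network.runs_findRadius`).

Algorithms are written as interaction trees (`Protocol`), which are composed by `Protocol.bind`;
`Network.Runs` describes the behaviour of a network all of whose nodes follow such protocols and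
halt in the same round.
-/

/-! ### Protocols as interaction trees -/

/-- The behaviour of a single node, as an interaction tree: it either halts with a result or sends
one message to all its neighbours and continues depending on the messages it receives. Unlike
`NodeProgram`s, protocols form a monad, so that they can be composed sequentially. -/
inductive Protocol (M α : Type) : Type
  | halt (a : α)
  | round (msg : M) (next : (ℕ → Option M) → Protocol M α)

namespace Protocol

variable {M α β : Type}

/-- Sequential composition: run `P`, then `f a` where `a` is the result of `P`. -/
def bind : Protocol M α → (α → Protocol M β) → Protocol M β
  | halt a, f => f a
  | round m k, f => round m fun inbox => (k inbox).bind f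

/-- Repeat `T` times: send `msg s`, where `s` is the current state, and update the state. -/
def iterate (msg : α → M) (upd : α → (ℕ → Option M) → α) : ℕ → α → Protocol M α
  | 0, s => halt s
  | T + 1, s => round (msg s) fun inbox => iterate msg upd T (upd s inbox)

/-- Run the protocols `f b` one after the other, for all `b` in a list, and collect the results. -/
def forList [DecidableEq β] (f : β → Protocol M α) (g : β → α) : List β → Protocol M (β → α)
  | [] => halt g
  | b :: l => (f b).bind fun a => (forList f g l).bind fun h =>
      halt (Function.update h b a)

/-- The node program in which the node with identifier `v` and incident multiplicities `t`
follows the protocol `P v t`. -/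
def toProgram [Inhabited M] (P : ℕ → (ℕ → ℕ) → Protocol M α) : NodeProgram M α where
  State := Protocol M α
  init := P
  send s _ := match s with
    | halt _ => default
    | round m _ => m
  step s inbox := match s with
    | halt a => halt a
    | round _ k => k inbox
  output s := match s with
    | halt a => some a
    | round _ _ => none
  output_step := by
    rintro (a | ⟨m, k⟩) inbox o h <;> simp_all

end Protocol

namespace Network

variable {M α β : Type} {G : Network}

/-- The messages received by `v` when every node `u` sends `msg u` to all its neighbours. -/
def inbox (G : Network) (msg : ℕ → M) (v u : ℕ) : Option M :=
  if G.mult u v = 0 then none else some (msg u)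

theorem inbox_eq_some {msg : ℕ → M} {u v : ℕ} {m : M} :
    G.inbox msg v u = some m ↔ G.mult u v ≠ 0 ∧ msg u = m := by
  unfold inbox; split_ifs <;> simp_all

/-- If every node `v` of `G` follows the protocol `P v`, then all nodes halt after exactly `T`
rounds, the node `v` with result `out v`. -/
def Runs (G : Network) : ℕ → (ℕ → Protocol M α) → (ℕ → α) → Prop
  | 0, P, out => ∀ v ∈ G.verts, P v = .halt (out v)
  | T + 1, P, out => ∃ (msg : ℕ → M) (next : ℕ → (ℕ → Option M) → Protocol M α),
      (∀ v ∈ G.verts, P v = .round (msg v) (next v)) ∧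
        G.Runs T (fun v => next v (G.inbox msg v)) out

theorem Runs.congr {T : ℕ} {P Q : ℕ → Protocol M α} {out out' : ℕ → α} (h : G.Runs T P out)
    (hP : ∀ v ∈ G.verts, P v = Q v) (hout : ∀ v ∈ G.verts, out v = out' v) :
    G.Runs T Q out' := by
  induction T generalizing P Q with
  | zero => intro v hv; rw [← hP v hv, h v hv, hout v hv]
  | succ T ih =>
    obtain ⟨m, k, h1, h2⟩ := h
    exact ⟨m, k, fun v hv => by rw [← hP v hv, h1 v hv], ih h2 fun _ _ => rfl⟩

theorem Runs.bind {T T' : ℕ} {P : ℕ → Protocol M α} {out : ℕ → α}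
    {Q : ℕ → α → Protocol M β} {out' : ℕ → β} (h : G.Runs T P out)
    (h' : G.Runs T' (fun v => Q v (out v)) out') :
    G.Runs (T + T') (fun v => (P v).bind (Q v)) out' := by
  induction T generalizing P with
  | zero =>
    rw [Nat.zero_add]
    exact h'.congr (fun v hv => by rw [h v hv]; rfl) fun _ _ => rfl
  | succ T ih =>
    obtain ⟨m, k, h1, h2⟩ := h
    rw [Nat.succ_add]
    exact ⟨m, fun v i => (k v i).bind (Q v), fun v hv => by simp only [h1 v hv, Protocol.bind], ih h2⟩

theorem runs_halt (out : ℕ → α) : G.Runs 0 (fun v => (.halt (out v) : Protocol M α)) out :=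
  fun _ _ => rfl

/-- Protocols that halt simultaneously on `G` give node programs that produce their output. -/
theorem Runs.outputs [Inhabited M] {T T' : ℕ} {P : ℕ → (ℕ → ℕ) → Protocol M α} {out : ℕ → α}
    (h : G.Runs T (fun v => P v (G.mult v)) out) (hT : T ≤ T') :
    (Protocol.toProgram P).Outputs G T' out := by
  have key : ∀ r ≤ T, ∃ Q : ℕ → Protocol M α, G.Runs (T - r) Q out ∧
      ∀ v ∈ G.verts, (Protocol.toProgram P).run G r v = Q v := by
    intro r
    induction r with
    | zero => exact fun _ => ⟨_, h, fun _ _ => rfl⟩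
    | succ r ih =>
      intro hr
      obtain ⟨Q, hQ, hrun⟩ := ih (by omega)
      rw [show T - r = T - (r + 1) + 1 by omega] at hQ
      obtain ⟨m, k, h1, h2⟩ := hQ
      refine ⟨_, h2, fun v hv => ?_⟩
      simp only [NodeProgram.run]
      rw [hrun v hv, h1 v hv]
      simp only [Protocol.toProgram]
      congr 1
      funext u
      unfold inbox
      split_ifs with hu
      · rfl
      · have := (hrun u (G.mem_of_mult u v hu)).trans (h1 u (G.mem_of_mult u v hu))
        simp only [Protocol.toProgram] at this
        rw [this]
  intro v hv
  induction T', hT using Nat.le_induction with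
  | base =>
    obtain ⟨Q, hQ, hrun⟩ := key T le_rfl
    rw [Nat.sub_self] at hQ
    rw [hrun v hv, hQ v hv]
    rfl
  | succ T' _ ih => exact NodeProgram.output_step _ _ _ _ ih

/-- An invariant of the global state is maintained by `Protocol.iterate`. -/
theorem runs_iterate {msg : α → M} {upd : ℕ → α → (ℕ → Option M) → α}
    (Inv : ℕ → (ℕ → α) → Prop) {T : ℕ} {s : ℕ → α} (h0 : Inv 0 s)
    (hstep : ∀ t s, Inv t s →
      Inv (t + 1) fun v => upd v (s v) (G.inbox (fun u => msg (s u)) v)) :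
    ∃ out, G.Runs T (fun v => Protocol.iterate msg (upd v) T (s v)) out ∧ Inv T out := by
  suffices H : ∀ t s, Inv t s → ∃ out,
      G.Runs T (fun v => Protocol.iterate msg (upd v) T (s v)) out ∧ Inv (t + T) out by
    simpa using H 0 s h0
  induction T with
  | zero => exact fun t s h => ⟨s, fun _ _ => rfl, h⟩
  | succ T ih =>
    intro t s h
    obtain ⟨out, hr, hi⟩ := ih (t + 1) _ (hstep t s h)
    refine ⟨out, ⟨_, _, fun v _ => rfl, hr⟩, ?_⟩
    rwa [show t + (T + 1) = t + 1 + T by omega]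

theorem runs_forList [DecidableEq β] {T : ℕ} {f : ℕ → β → Protocol M α} {g : ℕ → β → α}
    (Good : β → (ℕ → α) → Prop) (l : List β)
    (h : ∀ b ∈ l, ∃ out, G.Runs T (fun v => f v b) out ∧ Good b out) :
    ∃ out : ℕ → β → α, G.Runs (l.length * T) (fun v => Protocol.forList (f v) (g v) l) out ∧
      ∀ b ∈ l, Good b fun v => out v b := by
  induction l with
  | nil => exact ⟨g, by rw [List.length_nil, Nat.zero_mul]; exact runs_halt g, by simp⟩
  | cons b l ih =>
    obtain ⟨out, ho, hg⟩ := ih fun b hb => h b (List.mem_cons_of_mem _ hb)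
    obtain ⟨o, ho', hg'⟩ := h b List.mem_cons_self
    refine ⟨fun v => Function.update (out v) b (o v), ?_, fun b' hb' => ?_⟩
    · rw [List.length_cons, Nat.succ_mul, Nat.add_comm, ← Nat.add_zero (l.length * T)]
      exact ho'.bind (ho.bind (runs_halt _))
    · by_cases hbb : b' = b
      · subst hbb; simpa using hg'
      · simpa [Function.update_of_ne hbb] using hg b' ((List.mem_cons.1 hb').resolve_left hbb)

end Network

/-! ### Walks of bounded length -/

/-- `v` can be reached from `u` by at most `t` steps of the relation `R`. -/
def ReachIn (R : ℕ → ℕ → Prop) : ℕ → ℕ → ℕ → Prop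
  | 0, u, v => u = v
  | t + 1, u, v => ReachIn R t u v ∨ ∃ z, ReachIn R t u z ∧ R z v

namespace ReachIn

variable {R S : ℕ → ℕ → Prop} {t t' u v w : ℕ}

theorem refl (R : ℕ → ℕ → Prop) (t v : ℕ) : ReachIn R t v v := by
  induction t with
  | zero => rfl
  | succ t ih => exact Or.inl ih

theorem mono_right (h : ReachIn R t u v) (ht : t ≤ t') : ReachIn R t' u v := by
  induction t', ht using Nat.le_induction with
  | base => exact h
  | succ t' _ ih => exact Or.inl ih

theorem trans (h : ReachIn R t u v) (h' : ReachIn R t' v w) : ReachIn R (t + t') u w := by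
  induction t' generalizing w with
  | zero => obtain rfl : v = w := h'; exact h
  | succ t' ih =>
    rcases h' with h' | ⟨z, h', hz⟩
    · exact Or.inl (ih h')
    · exact Or.inr ⟨z, ih h', hz⟩

theorem single (h : R u v) : ReachIn R 1 u v := Or.inr ⟨u, rfl, h⟩

theorem symm (hR : ∀ a b, R a b → R b a) (h : ReachIn R t u v) : ReachIn R t v u := by
  induction t generalizing v with
  | zero => exact Eq.symm h
  | succ t ih =>
    rcases h with h | ⟨z, h, hz⟩
    · exact Or.inl (ih h)
    · rw [Nat.add_comm]; exact (single (hR _ _ hz)).trans (ih h)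

theorem mono (hRS : ∀ a b, R a b → S a b) (h : ReachIn R t u v) : ReachIn S t u v := by
  induction t generalizing v with
  | zero => exact h
  | succ t ih =>
    rcases h with h | ⟨z, h, hz⟩
    · exact Or.inl (ih h)
    · exact Or.inr ⟨z, ih h, hRS _ _ hz⟩

/-- A set that contains `u` but not `v` is left by some step on the way from `u` to `v`. -/
theorem exists_exit (h : ReachIn R t u v) (A : ℕ → Prop) (hu : A u) (hv : ¬ A v) :
    ∃ a b, R a b ∧ A a ∧ ¬ A b := by
  induction t generalizing v with
  | zero => obtain rfl : u = v := h; exact absurd hu hv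
  | succ t ih =>
    rcases h with h | ⟨z, h, hz⟩
    · exact ih h hv
    · by_cases hA : A z
      · exact ⟨z, v, hz, hA, hv⟩
      · exact ih h hA

theorem invariant (h : ReachIn R t u v) {p : ℕ → Prop} (hu : p u) (hp : ∀ a b, R a b → p b) :
    p v := by
  induction t generalizing v with
  | zero => obtain rfl : u = v := h; exact hu
  | succ t ih =>
    rcases h with h | ⟨z, h, hz⟩
    · exact ih h
    · exact hp _ _ hz

/-- If every vertex reachable from `u` is within distance `d` of a vertex in `Q`, then every
vertex reachable from `u` is within distance `|Q| * (2 d + 1)` of `u`: two vertices of a shortest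
path that are close to the same vertex of `Q` are at distance at most `2 d`. -/
theorem of_near_finset (hR : ∀ a b, R a b → R b a) {d : ℕ} {Q : Finset ℕ}
    (hQ : ∀ t x, ReachIn R t u x → ∃ p ∈ Q, ReachIn R d x p) (h : ReachIn R t u v) :
    ReachIn R (Q.card * (2 * d + 1)) u v := by
  classical
  let Exact : ℕ → ℕ → Prop := fun i x => ReachIn R i u x ∧ ∀ j < i, ¬ ReachIn R j u x
  have hex : ∃ t, ReachIn R t u v := ⟨t, h⟩
  obtain ⟨m, hm⟩ : ∃ m, Exact m v :=
    ⟨Nat.find hex, Nat.find_spec hex, fun j hj => Nat.find_min hex hj⟩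
  have hall : ∀ n x, Exact n x → ∀ i ≤ n, ∃ y, Exact i y := by
    intro n
    induction n with
    | zero => intro x hx i hi; exact ⟨x, by rwa [Nat.le_zero.1 hi]⟩
    | succ n ih =>
      intro x hx i hi
      rcases hi.eq_or_lt with rfl | hi
      · exact ⟨x, hx⟩
      rcases hx.1 with h1 | ⟨z, h1, hz⟩
      · exact absurd h1 (hx.2 n (Nat.lt_succ_self n))
      · refine ih z ⟨h1, fun j hj hjz => ?_⟩ i (Nat.lt_succ_iff.1 hi)
        exact hx.2 (j + 1) (by omega) (Or.inr ⟨z, hjz, hz⟩)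
  have : ∀ i : ℕ, ∃ y p, i ≤ m → Exact i y ∧ p ∈ Q ∧ ReachIn R d y p := by
    intro i
    by_cases hi : i ≤ m
    · obtain ⟨y, hy⟩ := hall m v hm i hi
      obtain ⟨p, hp, hyp⟩ := hQ i y hy.1
      exact ⟨y, p, fun _ => ⟨hy, hp, hyp⟩⟩
    · exact ⟨0, 0, fun h => absurd h hi⟩
  choose y p hyp using this
  have hfib : ∀ q ∈ Q, ((Finset.range (m + 1)).filter (p · = q)).card ≤ 2 * d + 1 := by
    intro q _
    rcases ((Finset.range (m + 1)).filter (p · = q)).eq_empty_or_nonempty with h0 | hne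
    · simp [h0]
    obtain ⟨i, hi, hmin⟩ := Finset.exists_min_image _ id hne
    have hsub : (Finset.range (m + 1)).filter (p · = q) ⊆ Finset.Icc i (i + 2 * d) := by
      intro j hj
      have hij := hmin j hj
      simp only [Finset.mem_filter, Finset.mem_range, id, Finset.mem_Icc] at *
      refine ⟨hij, ?_⟩
      by_contra hlt
      obtain ⟨hyi, -, hi'⟩ := hyp i (by omega)
      obtain ⟨hyj, -, hj'⟩ := hyp j (by omega)
      rw [hi.2] at hi'
      rw [hj.2] at hj'
      have := (hyi.1.trans hi').trans (hj'.symm hR)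
      exact hyj.2 (i + d + d) (by omega) this
    calc _ ≤ (Finset.Icc i (i + 2 * d)).card := Finset.card_le_card hsub
      _ = 2 * d + 1 := by rw [Nat.card_Icc]; omega
  have hcard := Finset.card_le_mul_card_image_of_maps_to (s := Finset.range (m + 1)) (t := Q)
    (f := p) (fun i hi => (hyp i (by simpa [Nat.lt_succ_iff] using hi)).2.1) _ hfib
  rw [Finset.card_range] at hcard
  exact hm.1.mono_right (by rw [Nat.mul_comm]; omega)

end ReachIn

/-! ### Flooding -/

namespace Network

/-- The neighbourhood relation of `G` on identifiers. -/
def Nbr (G : Network) (u v : ℕ) : Prop := G.mult u v ≠ 0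

theorem Nbr.symm {G : Network} {u v : ℕ} (h : G.Nbr u v) : G.Nbr v u := by
  unfold Nbr at *; rwa [G.mult_comm]

theorem Nbr.left_mem {G : Network} {u v : ℕ} (h : G.Nbr u v) : u ∈ G.verts := G.mem_of_mult _ _ h

theorem Nbr.right_mem {G : Network} {u v : ℕ} (h : G.Nbr u v) : v ∈ G.verts := h.symm.left_mem

end Network

namespace Protocol

variable {w : ℕ}

/-- Compute, by `T` rounds of flooding, the smallest of the numbers that are initially known to
the nodes within distance `T`. The numbers have to be smaller than `2 ^ w`. -/
noncomputable def minFlood (w T x : ℕ) : Protocol (BitVec w) ℕ :=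
  iterate (BitVec.ofNat w)
    (fun x inbox => sInf (insert x {y | ∃ u m, inbox u = some m ∧ m.toNat = y})) T x

open Classical in
/-- Breadth first search for `T` rounds in `w` graphs in parallel: the `b`-th bit of the state says
whether this node has been reached in the `b`-th graph, `hop b u` says whether the `b`-th graph has
an edge from the neighbour `u` to this node, and `start` says whether this node is the source. -/
noncomputable def search (T : ℕ) (hop : ℕ → ℕ → Prop) (start : Prop) :
    Protocol (BitVec w) (BitVec w) :=
  iterate id
    (fun s inbox => BitVec.ofFnLE fun b : Fin w => decide (s.getLsbD b = true ∨
      ∃ u m, inbox u = some m ∧ m.getLsbD b = true ∧ hop b u)) T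
    (BitVec.ofFnLE fun _ => decide start)

end Protocol

namespace Network

variable {G : Network} {w : ℕ}

theorem runs_minFlood (T : ℕ) {x : ℕ → ℕ} (hx : ∀ v ∈ G.verts, x v < 2 ^ w) :
    ∃ out : ℕ → ℕ, G.Runs T (fun v => Protocol.minFlood w T (x v)) out ∧
      ∀ v ∈ G.verts, (∃ u ∈ G.verts, ReachIn G.Nbr T u v ∧ out v = x u) ∧
        ∀ u ∈ G.verts, ReachIn G.Nbr T u v → out v ≤ x u := by
  refine runs_iterate (fun T out => ∀ v ∈ G.verts,
    (∃ u ∈ G.verts, ReachIn G.Nbr T u v ∧ out v = x u) ∧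
      ∀ u ∈ G.verts, ReachIn G.Nbr T u v → out v ≤ x u) (upd := fun _ => _) ?_ ?_
  · intro v hv
    exact ⟨⟨v, hv, rfl, rfl⟩, fun u _ h => by obtain rfl : u = v := h; exact le_rfl⟩
  · intro t s hs v hv
    have hmod : ∀ u ∈ G.verts, (BitVec.ofNat w (s u)).toNat = s u := by
      intro u hu
      obtain ⟨⟨z, hz, -, h⟩, -⟩ := hs u hu
      rw [BitVec.toNat_ofNat, h, Nat.mod_eq_of_lt (hx z hz)]
    set A : Set ℕ := insert (s v)
      {y | ∃ u m, G.inbox (fun u => BitVec.ofNat w (s u)) v u = some m ∧ m.toNat = y}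
    have hA : ∀ y, y ∈ A ↔ y = s v ∨ ∃ u, G.Nbr u v ∧ y = s u := by
      intro y
      simp only [A, Set.mem_insert_iff, Set.mem_ofPred_eq, inbox_eq_some]
      refine or_congr_right ⟨?_, ?_⟩
      · rintro ⟨u, m, ⟨h1, rfl⟩, rfl⟩
        exact ⟨u, h1, hmod u (G.mem_of_mult _ _ h1)⟩
      · rintro ⟨u, h1, rfl⟩
        exact ⟨u, _, ⟨h1, rfl⟩, hmod u h1.left_mem⟩
    constructor
    · rcases (hA _).1 (Nat.sInf_mem ⟨s v, (hA _).2 (Or.inl rfl)⟩) with h | ⟨z, hz, h⟩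
      · obtain ⟨⟨u, hu, hr, he⟩, -⟩ := hs v hv
        exact ⟨u, hu, Or.inl hr, h.trans he⟩
      · obtain ⟨⟨u, hu, hr, he⟩, -⟩ := hs z hz.left_mem
        exact ⟨u, hu, Or.inr ⟨z, hr, hz⟩, h.trans he⟩
    · rintro u hu (hr | ⟨z, hr, hz⟩)
      · exact (Nat.sInf_le ((hA _).2 (Or.inl rfl))).trans ((hs v hv).2 u hu hr)
      · exact (Nat.sInf_le ((hA _).2 (Or.inr ⟨z, hz, rfl⟩))).trans ((hs z hz.left_mem).2 u hu hr)

/-- If `T` is at least the diameter, then flooding computes the global minimum. -/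
theorem runs_minFlood_global {T : ℕ} {x : ℕ → ℕ} (hx : ∀ v ∈ G.verts, x v < 2 ^ w)
    (hne : G.verts.Nonempty) (hT : ∀ u ∈ G.verts, ∀ v ∈ G.verts, ReachIn G.Nbr T u v) :
    ∃ m, G.Runs T (fun v => Protocol.minFlood w T (x v)) (fun _ => m) ∧
      (∃ u ∈ G.verts, m = x u) ∧ ∀ u ∈ G.verts, m ≤ x u := by
  obtain ⟨out, hrun, h⟩ := runs_minFlood (w := w) T hx
  obtain ⟨r, hr, hmin⟩ := Finset.exists_min_image G.verts x hne
  refine ⟨x r, hrun.congr (fun _ _ => rfl) fun v hv => ?_, ⟨r, hr, rfl⟩, hmin⟩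
  obtain ⟨⟨u, hu, -, he⟩, hle⟩ := h v hv
  exact le_antisymm (hle r hr (hT r hr v hv)) (he ▸ hmin u hu)

/-- The search from `r` in the graphs `R b`, for all `b < w`. -/
theorem runs_search (T : ℕ) (R : ℕ → ℕ → ℕ → Prop) (hR : ∀ b u v, R b u v → G.Nbr u v) (r : ℕ) :
    ∃ out : ℕ → BitVec w, G.Runs T (fun v => Protocol.search T (fun b u => R b u v) (v = r)) out ∧
      ∀ v, ∀ b < w, (out v).getLsbD b = true ↔ ReachIn (R b) T r v := by
  classical
  refine runs_iterate (M := BitVec w) (msg := id) (fun T (out : ℕ → BitVec w) =>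
    ∀ v, ∀ b < w, (out v).getLsbD b = true ↔ ReachIn (R b) T r v)
    (upd := fun v s inbox => BitVec.ofFnLE fun b : Fin w => decide (s.getLsbD b = true ∨
      ∃ u m, inbox u = some m ∧ m.getLsbD b = true ∧ R b u v)) ?_ ?_
  · intro v b hb
    rw [BitVec.getLsbD_eq_getElem hb, BitVec.getElem_ofFnLE _ _ hb]
    simp [ReachIn, eq_comm]
  · intro t s hs v b hb
    rw [BitVec.getLsbD_eq_getElem hb, BitVec.getElem_ofFnLE _ _ hb]
    simp only [decide_eq_true_eq, hs v b hb, ReachIn, inbox_eq_some, id]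
    refine or_congr_right ⟨?_, ?_⟩
    · rintro ⟨u, m, ⟨-, rfl⟩, h1, h2⟩
      exact ⟨u, (hs u b hb).1 h1, h2⟩
    · rintro ⟨u, h1, h2⟩
      exact ⟨u, _, ⟨hR _ _ _ h2, rfl⟩, (hs u b hb).2 h1, h2⟩

end Network

/-! ### Estimating the diameter -/

namespace Protocol

/-- Determine, for `d = d₀, d₀ + 1, …`, the smallest identifier within distance `d`, and then
whether some node within distance `2 d + 1` has obtained a different result; return the first `d`
for which this is not the case. The argument after `v` bounds the number of values that are tried. -/
noncomputable def findRadius (w v : ℕ) : ℕ → ℕ → Protocol (BitVec w) ℕ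
  | 0, d => halt d
  | fuel + 1, d =>
    (minFlood w d v).bind fun l =>
    (minFlood w (2 * d + 1) l).bind fun a =>
    (minFlood w (2 * d + 1) (2 ^ w - 1 - l)).bind fun b =>
    if a = l ∧ b = 2 ^ w - 1 - l then halt d else findRadius w v fuel (d + 1)

/-- Collect the `j` smallest identifiers that do not occur in the list `l`. -/
noncomputable def collect (w v T : ℕ) : ℕ → List ℕ → Protocol (BitVec w) (List ℕ)
  | 0, l => halt l
  | j + 1, l => (minFlood w T (if v ∈ l then 2 ^ w - 1 else v)).bind fun m =>
      collect w v T j (m :: l)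

end Protocol

namespace Network

variable {G : Network} {w : ℕ}

/-- All nodes agree on the outcome of one iteration of `Protocol.findRadius`. If not all nodes have
the same label, then each node sees a label different from its own within distance `2 d + 1`, since
the nodes with its label are all within distance `d` of the node with that identifier. -/
theorem runs_findRadius (hw : ∀ v ∈ G.verts, v < 2 ^ w) {D : ℕ}
    (hD : ∀ u ∈ G.verts, ∀ v ∈ G.verts, ReachIn G.Nbr D u v) (fuel d : ℕ) (hd : d ≤ D)
    (hfuel : D < d + fuel) :
    ∃ d' T, d' ≤ D ∧ T ≤ (D + 1 - d) * (5 * D + 2) ∧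
      G.Runs T (fun v => Protocol.findRadius w v fuel d) (fun _ => d') ∧
      ∀ u ∈ G.verts, ∀ v ∈ G.verts, ReachIn G.Nbr (2 * d') u v := by
  induction fuel generalizing d with
  | zero => omega
  | succ fuel ih =>
    obtain ⟨l, hl, hl'⟩ := runs_minFlood (G := G) (w := w) d (x := id) hw
    have hlw : ∀ v ∈ G.verts, l v < 2 ^ w := by
      intro v hv
      obtain ⟨⟨u, hu, -, h⟩, -⟩ := hl' v hv
      rw [h]; exact hw u hu
    obtain ⟨a, ha, ha'⟩ := runs_minFlood (G := G) (w := w) (2 * d + 1) (x := l) hlw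
    obtain ⟨b, hb, hb'⟩ := runs_minFlood (G := G) (w := w) (2 * d + 1)
      (x := fun v => 2 ^ w - 1 - l v) (fun v _ => by have := Nat.two_pow_pos w; omega)
    have hsame : ∀ v ∈ G.verts, ((a v = l v ∧ b v = 2 ^ w - 1 - l v) ↔
        ∀ u ∈ G.verts, ∀ u' ∈ G.verts, l u = l u') := by
      intro v hv
      constructor
      · rintro ⟨h1, h2⟩
        have hloc : ∀ u ∈ G.verts, ReachIn G.Nbr (2 * d + 1) u v → l u = l v := by
          intro u hu hr
          have h3 := (ha' v hv).2 u hu hr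
          have h4 := (hb' v hv).2 u hu hr
          have h5 := hlw u hu
          have h6 := hlw v hv
          omega
        suffices H : ∀ u ∈ G.verts, l u = l v from fun u hu u' hu' => (H u hu).trans (H u' hu').symm
        by_contra! hcon
        obtain ⟨u, hu, huv⟩ := hcon
        obtain ⟨y, z, hyz, hy, hz⟩ := (hD v hv u hu).exists_exit (fun x => l x = l v) rfl huv
        obtain ⟨⟨x, hx, hxv, hlx⟩, -⟩ := hl' v hv
        obtain ⟨⟨x', hx', hxy, hlx'⟩, -⟩ := hl' y hyz.left_mem
        obtain rfl : x' = x := by simpa [hy, hlx, eq_comm] using hlx'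
        apply hz
        apply hloc z hyz.right_mem
        have := ((ReachIn.single hyz).symm fun _ _ => Nbr.symm).trans
          ((hxy.symm fun _ _ => Nbr.symm).trans hxv)
        exact this.mono_right (by omega)
      · intro h
        obtain ⟨⟨u, hu, -, h1⟩, -⟩ := ha' v hv
        obtain ⟨⟨u', hu', -, h2⟩, -⟩ := hb' v hv
        exact ⟨h1.trans (h u hu v hv), by rw [h2, h u' hu' v hv]⟩
    by_cases hok : ∀ u ∈ G.verts, ∀ u' ∈ G.verts, l u = l u'
    · refine ⟨d, d + (2 * d + 1 + (2 * d + 1 + 0)), hd, ?_, ?_, ?_⟩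
      · calc _ ≤ 1 * (5 * D + 2) := by omega
          _ ≤ _ := Nat.mul_le_mul_right _ (by omega)
      · refine hl.bind (ha.bind (hb.bind ((runs_halt _).congr (fun v hv => ?_) fun _ _ => rfl)))
        rw [if_pos ((hsame v hv).2 hok)]
      · intro u hu v hv
        obtain ⟨⟨x, hx, hxu, h1⟩, -⟩ := hl' u hu
        obtain ⟨⟨x', hx', hxv, h2⟩, -⟩ := hl' v hv
        obtain rfl : x = x' := h1.symm.trans ((hok u hu v hv).trans h2)
        rw [Nat.two_mul]
        exact (hxu.symm fun _ _ => Nbr.symm).trans hxv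
    · have hdD : d ≠ D := by
        rintro rfl
        refine hok fun u hu u' hu' => ?_
        obtain ⟨⟨x, hx, hxu, h1⟩, h1'⟩ := hl' u hu
        obtain ⟨⟨x', hx', hxu', h2⟩, h2'⟩ := hl' u' hu'
        have h3 := h1' x' hx' (hD x' hx' u hu)
        have h4 := h2' x hx (hD x hx u' hu')
        simp only [id] at *
        omega
      obtain ⟨d', T, hd', hT, hrun, hrad⟩ := ih (d + 1) (by omega) (by omega)
      refine ⟨d', d + (2 * d + 1 + (2 * d + 1 + T)), hd', ?_, ?_, hrad⟩
      · obtain ⟨e, rfl⟩ := Nat.exists_eq_add_of_lt (lt_of_le_of_ne hd hdD)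
        rw [show d + e + 1 + 1 - (d + 1) = e + 1 by omega] at hT
        rw [show d + e + 1 + 1 - d = e + 1 + 1 by omega, Nat.add_mul (e + 1) 1, Nat.one_mul]
        omega
      · refine hl.bind (ha.bind (hb.bind (hrun.congr (fun v hv => ?_) fun _ _ => rfl)))
        rw [if_neg fun h => hok ((hsame v hv).1 h)]

/-- The nodes agree on a list that contains all nodes, or `j` more of them than the initial list.
When the nodes are exhausted, the number `2 ^ w - 1` is added instead. -/
theorem runs_collect (hne : G.verts.Nonempty) (hw : ∀ v ∈ G.verts, v < 2 ^ w - 1) {T : ℕ}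
    (hT : ∀ u ∈ G.verts, ∀ v ∈ G.verts, ReachIn G.Nbr T u v) (j : ℕ) (l : List ℕ) (i : ℕ)
    (hl : (∀ v ∈ G.verts, v ∈ l) ∨ i ≤ (G.verts.filter (· ∈ l)).card) :
    ∃ l' : List ℕ, l'.length = j + l.length ∧
      G.Runs (j * T) (fun v => Protocol.collect w v T j l) (fun _ => l') ∧
      ((∀ v ∈ G.verts, v ∈ l') ∨ i + j ≤ (G.verts.filter (· ∈ l')).card) ∧
      ∀ s ∈ l', s ∈ l ∨ s = 2 ^ w - 1 ∨ s ∈ G.verts := by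
  induction j generalizing l i with
  | zero => exact ⟨l, by simp, by rw [Nat.zero_mul]; exact runs_halt _, hl, fun s hs => Or.inl hs⟩
  | succ j ih =>
    obtain ⟨m, hrun, ⟨u, hu, hmu⟩, hm⟩ := runs_minFlood_global (w := w) (G := G) (T := T)
      (x := fun v => if v ∈ l then 2 ^ w - 1 else v)
      (fun v hv => by have := hw v hv; split_ifs <;> omega) hne hT
    obtain ⟨l', hlen, hrun', hl', hmem⟩ := ih (m :: l) (i + 1) <| by
      by_cases hall : ∀ v ∈ G.verts, v ∈ l
      · exact Or.inl fun v hv => List.mem_cons_of_mem _ (hall v hv)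
      · right
        have hi := hl.resolve_left hall
        push Not at hall
        obtain ⟨v, hv, hvl⟩ := hall
        have hul : u ∉ l := by
          intro h
          have h1 := hm v hv
          have h2 := hw v hv
          rw [if_neg hvl] at h1
          rw [if_pos h] at hmu
          omega
        rw [if_neg hul] at hmu
        subst hmu
        calc i + 1 ≤ (G.verts.filter (· ∈ l)).card + 1 := by omega
          _ = (insert m (G.verts.filter (· ∈ l))).card :=
            (Finset.card_insert_of_notMem (by simp [hul])).symm
          _ ≤ _ := Finset.card_le_card fun x hx => by
            rcases Finset.mem_insert.1 hx with rfl | hx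
            · simp [hu]
            · simp only [Finset.mem_filter] at hx ⊢
              exact ⟨hx.1, List.mem_cons_of_mem _ hx.2⟩
    refine ⟨l', by rw [hlen, List.length_cons]; omega, ?_, ?_, fun s hs => ?_⟩
    · rw [Nat.succ_mul, Nat.add_comm]
      exact hrun.bind hrun'
    · rwa [Nat.add_right_comm, Nat.add_assoc] at hl'
    · rcases hmem s hs with h | h
      · rcases List.mem_cons.1 h with rfl | h
        · right
          rw [hmu]
          split_ifs
          · exact Or.inl rfl
          · exact Or.inr hu
        · exact Or.inl h
      · exact Or.inr h

end Network

/-! ### Families of sets that hit and miss -/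

section Families

open Finset

variable {α : Type} [DecidableEq α]

/-- The pairs of disjoint subsets of `U`, of cardinality at most `k` and `l` respectively. -/
def disjointPairs (U : Finset α) (k l : ℕ) : Finset (Finset α × Finset α) :=
  (U.powerset ×ˢ U.powerset).filter fun P => P.1.card ≤ k ∧ P.2.card ≤ l ∧ Disjoint P.1 P.2

theorem card_filter_powerset_le (U : Finset α) (k : ℕ) :
    (U.powerset.filter (·.card ≤ k)).card ≤ (U.card + 1) ^ k := by
  induction k with
  | zero =>
    rw [pow_zero]
    refine card_le_one.2 fun a ha b hb => ?_
    simp only [mem_filter, Nat.le_zero, card_eq_zero] at ha hb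
    rw [ha.2, hb.2]
  | succ k ih =>
    have hsub : U.powerset.filter (·.card ≤ k + 1) ⊆
        ((insertNone U) ×ˢ U.powerset.filter (·.card ≤ k)).image
          fun p => p.1.elim p.2 (insert · p.2) := by
      intro F hF
      simp only [mem_filter, mem_powerset] at hF
      rw [mem_image]
      rcases F.eq_empty_or_nonempty with rfl | ⟨x, hx⟩
      · exact ⟨(none, ∅), by simp, rfl⟩
      · refine ⟨(some x, F.erase x), ?_, by simp [insert_erase hx]⟩
        simp only [mem_product, some_mem_insertNone, mem_filter, mem_powerset]
        refine ⟨hF.1 hx, (erase_subset _ _).trans hF.1, ?_⟩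
        rw [card_erase_of_mem hx]; omega
    calc _ ≤ _ := card_le_card hsub
      _ ≤ _ := card_image_le
      _ = (U.card + 1) * (U.powerset.filter (·.card ≤ k)).card := by
        rw [card_product, card_insertNone]
      _ ≤ (U.card + 1) * (U.card + 1) ^ k := Nat.mul_le_mul_left _ ih
      _ = _ := (pow_succ' _ _).symm

theorem card_disjointPairs_le (U : Finset α) (k l : ℕ) :
    (disjointPairs U k l).card ≤ (U.card + 1) ^ (k + l) := by
  have hsub : disjointPairs U k l ⊆
      U.powerset.filter (·.card ≤ k) ×ˢ U.powerset.filter (·.card ≤ l) := by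
    intro P hP
    simp only [disjointPairs, mem_filter, mem_product] at hP ⊢
    tauto
  calc _ ≤ _ := card_le_card hsub
    _ = _ := card_product _ _
    _ ≤ _ := Nat.mul_le_mul (card_filter_powerset_le U k) (card_filter_powerset_le U l)
    _ = _ := (pow_add _ _ _).symm

/-- If every element of `U` is put into `Z` independently with probability `1 / (2 l)`, then
`F ⊆ Z` and `Disjoint E Z` hold with probability at least `1 / (2 (2 l) ^ k)`, for all disjoint
`F` and `E` of cardinality at most `k` and `l`. So some `Z` serves this fraction of the pairs. -/
theorem exists_subset_serving (U : Finset α) {k l : ℕ} (hl : 0 < l)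
    {𝒬 : Finset (Finset α × Finset α)} (h𝒬 : 𝒬 ⊆ disjointPairs U k l) :
    ∃ Z ⊆ U, 𝒬.card ≤ 2 * (2 * l) ^ k * (𝒬.filter fun P => P.1 ⊆ Z ∧ Disjoint P.2 Z).card := by
  set p : ℝ := 1 / (2 * l) with hp
  have hl' : (0 : ℝ) < l := by exact_mod_cast hl
  have hl1 : (1 : ℝ) ≤ l := by exact_mod_cast hl
  have hp0 : 0 < p := by positivity
  have hp1 : p ≤ 1 / 2 := by
    rw [hp, div_le_div_iff₀ (by positivity) (by norm_num)]; linarith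
  let wt : Finset α → ℝ := fun Z => (∏ _i ∈ Z, p) * ∏ _i ∈ U \ Z, (1 - p)
  have hwt0 : ∀ Z, 0 ≤ wt Z := fun Z =>
    mul_nonneg (prod_nonneg fun _ _ => hp0.le) (prod_nonneg fun _ _ => by linarith)
  have hwt1 : ∑ Z ∈ U.powerset, wt Z = 1 := by
    rw [← prod_add]; simp
  have hprob : ∀ P ∈ 𝒬, (1 : ℝ) / (2 * (2 * l) ^ k) ≤
      ∑ Z ∈ U.powerset, if P.1 ⊆ Z ∧ Disjoint P.2 Z then wt Z else 0 := by
    intro P hP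
    have hP' := h𝒬 hP
    simp only [disjointPairs, mem_filter, mem_product, mem_powerset] at hP'
    obtain ⟨⟨hF, hE⟩, hFk, hEl, hdis⟩ := hP'
    have hsum : ∑ Z ∈ U.powerset, (if P.1 ⊆ Z ∧ Disjoint P.2 Z then wt Z else 0) =
        ∏ i ∈ U, ((if i ∈ P.2 then 0 else p) + (if i ∈ P.1 then 0 else 1 - p)) := by
      rw [prod_add]
      refine sum_congr rfl fun Z _ => ?_
      split_ifs with hZ
      · refine congr_arg₂ _ (prod_congr rfl fun i hi => ?_) (prod_congr rfl fun i hi => ?_)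
        · rw [if_neg fun h => disjoint_left.1 hZ.2 h hi]
        · rw [if_neg fun h => (mem_sdiff.1 hi).2 (hZ.1 h)]
      · rw [not_and_or] at hZ
        rcases hZ with hZ | hZ
        · obtain ⟨i, hi, hiZ⟩ := not_subset.1 hZ
          rw [prod_eq_zero (i := i) (s := U \ Z) (mem_sdiff.2 ⟨hF hi, hiZ⟩) (by simp [hi]),
            mul_zero]
        · obtain ⟨i, hi, hiZ⟩ := not_disjoint_iff.1 hZ
          rw [prod_eq_zero (i := i) (s := Z) hiZ (by simp [hi]), zero_mul]
    have hprod : ∏ i ∈ U, ((if i ∈ P.2 then 0 else p) + (if i ∈ P.1 then 0 else 1 - p)) =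
        p ^ P.1.card * (1 - p) ^ P.2.card := by
      have : ∀ i ∈ U, ((if i ∈ P.2 then 0 else p) + (if i ∈ P.1 then 0 else 1 - p)) =
          (if i ∈ P.1 then p else 1) * (if i ∈ P.2 then 1 - p else 1) := by
        intro i _
        by_cases h1 : i ∈ P.1
        · simp [h1, disjoint_left.1 hdis h1]
        · by_cases h2 : i ∈ P.2 <;> simp [h1, h2]
      rw [prod_congr rfl this, prod_mul_distrib, prod_ite_mem, prod_ite_mem, prod_const,
        prod_const, inter_eq_right.2 hF, inter_eq_right.2 hE]
    rw [hsum, hprod]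
    have h1 : p ^ k ≤ p ^ P.1.card := pow_le_pow_of_le_one hp0.le (by linarith) hFk
    have h2 : (1 - p) ^ l ≤ (1 - p) ^ P.2.card :=
      pow_le_pow_of_le_one (by linarith) (by linarith) hEl
    have h3 : (1 : ℝ) / 2 ≤ (1 - p) ^ l := by
      have := one_add_mul_le_pow (a := -p) (by linarith) l
      have h4 : (l : ℝ) * p = 1 / 2 := by rw [hp]; field_simp
      calc (1 : ℝ) / 2 = 1 + l * -p := by linarith
        _ ≤ _ := this
        _ = _ := by ring
    calc (1 : ℝ) / (2 * (2 * l) ^ k) = p ^ k * (1 / 2) := by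
          rw [hp, one_div_pow]; field_simp
      _ ≤ p ^ P.1.card * (1 - p) ^ P.2.card :=
          mul_le_mul h1 (h3.trans h2) (by norm_num) (by positivity)
  by_contra! hcon
  have hlt : ∑ Z ∈ U.powerset, wt Z *
      (2 * (2 * l) ^ k * (𝒬.filter fun P => P.1 ⊆ Z ∧ Disjoint P.2 Z).card) <
        ∑ Z ∈ U.powerset, wt Z * (𝒬.card : ℝ) := by
    have hle : ∀ Z ∈ U.powerset, wt Z *
      (2 * (2 * l) ^ k * (𝒬.filter fun P => P.1 ⊆ Z ∧ Disjoint P.2 Z).card) ≤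
        wt Z * (𝒬.card : ℝ) := fun Z hZ =>
      mul_le_mul_of_nonneg_left (by exact_mod_cast (hcon Z (mem_powerset.1 hZ)).le) (hwt0 Z)
    refine sum_lt_sum hle ?_
    obtain ⟨Z, hZ, hpos⟩ := exists_ne_zero_of_sum_ne_zero (hwt1.trans_ne one_ne_zero)
    exact ⟨Z, hZ, mul_lt_mul_of_pos_left (by exact_mod_cast hcon Z (mem_powerset.1 hZ))
      ((hwt0 Z).lt_of_ne' hpos)⟩
  rw [← sum_mul, hwt1, one_mul] at hlt
  have hge : (𝒬.card : ℝ) ≤ ∑ Z ∈ U.powerset, wt Z *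
      (2 * (2 * l) ^ k * (𝒬.filter fun P => P.1 ⊆ Z ∧ Disjoint P.2 Z).card) := by
    have hpos : (0 : ℝ) < 2 * (2 * l) ^ k := by positivity
    calc (𝒬.card : ℝ) = 2 * (2 * l) ^ k * ∑ P ∈ 𝒬, (1 : ℝ) / (2 * (2 * l) ^ k) := by
          rw [sum_const, nsmul_eq_mul]; field_simp
      _ ≤ 2 * (2 * l) ^ k * ∑ P ∈ 𝒬, ∑ Z ∈ U.powerset,
            if P.1 ⊆ Z ∧ Disjoint P.2 Z then wt Z else 0 :=
          mul_le_mul_of_nonneg_left (sum_le_sum hprob) hpos.le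
      _ = _ := by
          rw [sum_comm, mul_sum]
          refine sum_congr rfl fun Z _ => ?_
          rw [← sum_filter, sum_const, nsmul_eq_mul]
          ring
  linarith

/-- There are `2 (2 l) ^ k * s` sets that serve all disjoint pairs, provided that there are fewer
than `2 ^ s` pairs: choosing the sets greedily, `2 (2 l) ^ k` steps halve the number of pairs that
have not been served. -/
theorem exists_serving_family (U : Finset α) {k l s : ℕ} (hl : 0 < l)
    (hs : (disjointPairs U k l).card < 2 ^ s) :
    ∃ Z : ℕ → Finset α, (∀ i, Z i ⊆ U) ∧ ∀ P ∈ disjointPairs U k l,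
      ∃ i < 2 * (2 * l) ^ k * s, P.1 ⊆ Z i ∧ Disjoint P.2 (Z i) := by
  classical
  set W := 2 * (2 * l) ^ k with hW
  have hWpos : 0 < W := by positivity
  have hWR : (0 : ℝ) < W := by exact_mod_cast hWpos
  have hW1 : (1 : ℝ) ≤ W := by exact_mod_cast hWpos
  have greedy : ∀ m : ℕ, ∃ Z : ℕ → Finset α, (∀ i, Z i ⊆ U) ∧
      (((disjointPairs U k l).filter fun P => ¬ ∃ i < m, P.1 ⊆ Z i ∧ Disjoint P.2 (Z i)).card : ℝ)
        ≤ (1 - 1 / W) ^ m * (disjointPairs U k l).card := by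
    intro m
    induction m with
    | zero => exact ⟨fun _ => ∅, by simp, by simp⟩
    | succ m ih =>
      obtain ⟨Z, hZ, hcard⟩ := ih
      set 𝒬 := (disjointPairs U k l).filter fun P => ¬ ∃ i < m, P.1 ⊆ Z i ∧ Disjoint P.2 (Z i)
      obtain ⟨Y, hY, hserve⟩ := exists_subset_serving U hl (𝒬 := 𝒬) (filter_subset _ _)
      refine ⟨Function.update Z m Y, fun i => ?_, ?_⟩
      · by_cases hi : i = m
        · subst hi; simpa using hY
        · simpa [Function.update_of_ne hi] using hZ i
      · have hsub : ((disjointPairs U k l).filter fun P => ¬ ∃ i < m + 1,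
            P.1 ⊆ Function.update Z m Y i ∧ Disjoint P.2 (Function.update Z m Y i)) ⊆
            𝒬.filter fun P => ¬ (P.1 ⊆ Y ∧ Disjoint P.2 Y) := by
          intro P hP
          simp only [𝒬, mem_filter] at hP ⊢
          refine ⟨⟨hP.1, fun ⟨i, hi, h⟩ => hP.2 ⟨i, by omega, ?_⟩⟩,
            fun h => hP.2 ⟨m, by omega, ?_⟩⟩
          · rwa [Function.update_of_ne (by omega)]
          · rwa [Function.update_self]
        have h1 := card_filter_add_card_filter_not (s := 𝒬) fun P => P.1 ⊆ Y ∧ Disjoint P.2 Y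
        have h2 : ((𝒬.filter fun P => P.1 ⊆ Y ∧ Disjoint P.2 Y).card : ℝ) +
            ((𝒬.filter fun P => ¬ (P.1 ⊆ Y ∧ Disjoint P.2 Y)).card : ℝ) = 𝒬.card := by
          exact_mod_cast h1
        have h3 : (𝒬.card : ℝ) ≤ W * ((𝒬.filter fun P => P.1 ⊆ Y ∧ Disjoint P.2 Y).card : ℝ) := by
          exact_mod_cast hserve
        have h4 : (1 / W : ℝ) * 𝒬.card ≤
            ((𝒬.filter fun P => P.1 ⊆ Y ∧ Disjoint P.2 Y).card : ℝ) := by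
          rw [one_div, inv_mul_le_iff₀ hWR]; exact h3
        have h5 : (0 : ℝ) ≤ 1 - 1 / W := by
          rw [sub_nonneg, div_le_one hWR]; exact hW1
        calc _ ≤ ((𝒬.filter fun P => ¬ (P.1 ⊆ Y ∧ Disjoint P.2 Y)).card : ℝ) := by
              exact_mod_cast card_le_card hsub
          _ ≤ (1 - 1 / W) * 𝒬.card := by linarith
          _ ≤ (1 - 1 / W) * ((1 - 1 / W) ^ m * (disjointPairs U k l).card) :=
              mul_le_mul_of_nonneg_left hcard h5
          _ = _ := by ring
  obtain ⟨Z, hZ, hcard⟩ := greedy (W * s)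
  refine ⟨Z, hZ, fun P hP => ?_⟩
  have hhalf : (1 - 1 / W : ℝ) ^ W ≤ 1 / 2 := by
    have h1 : (1 - 1 / W : ℝ) ≤ Real.exp (-(1 / W)) := by
      have := Real.add_one_le_exp (-(1 / W : ℝ)); linarith
    have h5 : (0 : ℝ) ≤ 1 - 1 / W := by
      rw [sub_nonneg, div_le_one hWR]; exact hW1
    calc (1 - 1 / W : ℝ) ^ W ≤ Real.exp (-(1 / W)) ^ W := pow_le_pow_left₀ h5 h1 _
      _ = Real.exp (-1) := by rw [← Real.exp_nat_mul]; congr 1; field_simp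
      _ ≤ 1 / 2 := by
        rw [Real.exp_neg, one_div]
        exact inv_anti₀ (by norm_num) (by have := Real.add_one_le_exp (1 : ℝ); linarith)
  have hzero : (((disjointPairs U k l).filter
      fun P => ¬ ∃ i < W * s, P.1 ⊆ Z i ∧ Disjoint P.2 (Z i)).card : ℝ) < 1 := by
    have h5 : (0 : ℝ) ≤ 1 - 1 / W := by
      rw [sub_nonneg, div_le_one hWR]; exact hW1
    have h6 : ((disjointPairs U k l).card : ℝ) < 2 ^ s := by exact_mod_cast hs
    calc _ ≤ _ := hcard
      _ = ((1 - 1 / W : ℝ) ^ W) ^ s * (disjointPairs U k l).card := by rw [pow_mul]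
      _ ≤ (1 / 2) ^ s * (disjointPairs U k l).card :=
          mul_le_mul_of_nonneg_right (pow_le_pow_left₀ (pow_nonneg h5 _) hhalf _) (by positivity)
      _ < (1 / 2) ^ s * 2 ^ s := mul_lt_mul_of_pos_left h6 (by positivity)
      _ = 1 := by rw [← mul_pow]; norm_num
  have hempty : ((disjointPairs U k l).filter
      fun P => ¬ ∃ i < W * s, P.1 ⊆ Z i ∧ Disjoint P.2 (Z i)) = ∅ := by
    rw [← card_eq_zero]; exact_mod_cast Nat.lt_one_iff.1 (by exact_mod_cast hzero)
  by_contra hno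
  exact notMem_empty P (hempty ▸ mem_filter.2 ⟨hP, hno⟩)

/-- The number of groups of sets in the family of `exists_grouped_family`. -/
def groupCount (k l : ℕ) : ℕ := 2 * (2 * l) ^ k * (k + l + 1)

/-- A family that serves all disjoint pairs, divided into groups of `w` sets. As the size of the
family is proportional to the logarithm of the size of `U`, the number of groups does not depend
on `U`. -/
theorem exists_grouped_family (U : Finset α) {k l w : ℕ} (hl : 0 < l) (hw : 0 < w)
    (hU : U.card < 2 ^ w) :
    ∃ Z : ℕ → ℕ → Finset α, (∀ g b, Z g b ⊆ U) ∧ ∀ F ⊆ U, ∀ E ⊆ U, F.card ≤ k → E.card ≤ l →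
      Disjoint F E → ∃ g < groupCount k l, ∃ b < w, F ⊆ Z g b ∧ Disjoint E (Z g b) := by
  have hs : (disjointPairs U k l).card < 2 ^ (w * (k + l + 1)) := by
    calc _ ≤ (U.card + 1) ^ (k + l) := card_disjointPairs_le U k l
      _ ≤ (2 ^ w) ^ (k + l) := Nat.pow_le_pow_left hU _
      _ = 2 ^ (w * (k + l)) := (pow_mul _ _ _).symm
      _ < _ := Nat.pow_lt_pow_right (by norm_num) (by rw [Nat.mul_succ]; omega)
  obtain ⟨Z, hZ, hserve⟩ := exists_serving_family U hl hs
  refine ⟨fun g b => Z (b + w * g), fun g b => hZ _, fun F hF E hE hFk hEl hdis => ?_⟩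
  obtain ⟨i, hi, h⟩ := hserve (F, E) (by simp [disjointPairs, *])
  refine ⟨i / w, ?_, i % w, Nat.mod_lt _ hw, ?_⟩
  · rw [Nat.div_lt_iff_lt_mul hw, groupCount, Nat.mul_assoc, Nat.mul_comm _ w]; exact hi
  · simpa [Nat.mod_add_div] using h

end Families

/-! ### Separation in a network with deleted elements -/

/-- The common features of edge cuts and vertex cuts. Finite sets of elements of type `α` (names of
edges, or vertices) can be deleted from a network; `Hop Z t u v` says that a message can pass from
`u` to `v` after the deletion of `Z` if `u` and `v` are joined by `t` edges, and `dead Z` is the set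
of vertices that disappear when `Z` is deleted. -/
structure CutModel (α : Type) [DecidableEq α] where
  Hop : Finset α → ℕ → ℕ → ℕ → Prop
  dead : Finset α → Finset ℕ
  ne_zero_of_hop : ∀ {Z t u v}, Hop Z t u v → t ≠ 0
  hop_symm : ∀ {Z t u v}, Hop Z t u v → Hop Z t v u
  hop_anti : ∀ {F Z t u v}, F ⊆ Z → Hop Z t u v → Hop F t u v
  notMem_dead_of_hop : ∀ {Z t u v}, Hop Z t u v → v ∉ dead Z
  /-- A hop depends on at most two elements. -/
  hop_local : ∀ {F t u v}, Hop F t u v →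
    ∃ E : Finset α, E.card ≤ 2 ∧ Disjoint E F ∧ ∀ Z, Disjoint E Z → Hop Z t u v
  card_dead_le : ∀ F, (dead F).card ≤ F.card

namespace CutModel

variable {α : Type} [DecidableEq α] (M : CutModel α) (G : Network)

/-- The neighbourhood relation of `G` after the deletion of `Z`. -/
def Step (Z : Finset α) (u v : ℕ) : Prop := M.Hop Z (G.mult v u) u v

/-- The vertices `u` and `v` survive the deletion of `F`, but are no longer connected. -/
def Separates (F : Finset α) (u v : ℕ) : Prop :=
  u ∉ M.dead F ∧ v ∉ M.dead F ∧ ∀ t, ¬ ReachIn (M.Step G F) t u v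

variable {M G} {F : Finset α} {u v s t : ℕ}

theorem Step.nbr (h : M.Step G F u v) : G.Nbr u v :=
  Network.Nbr.symm (u := v) (v := u) (M.ne_zero_of_hop h)

theorem Step.symm (h : M.Step G F u v) : M.Step G F v u := by
  unfold Step at *; rw [G.mult_comm]; exact M.hop_symm h

/-- A walk of length `t` depends on at most `2 t` elements. -/
theorem exists_support (h : ReachIn (M.Step G F) t u v) :
    ∃ E : Finset α, E.card ≤ 2 * t ∧ Disjoint E F ∧
      ∀ Z, Disjoint E Z → ReachIn (M.Step G Z) t u v := by
  induction t generalizing v with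
  | zero => exact ⟨∅, by simp, by simp, fun _ _ => h⟩
  | succ t ih =>
    rcases h with h | ⟨z, h, hz⟩
    · obtain ⟨E, h1, h2, h3⟩ := ih h
      exact ⟨E, by omega, h2, fun Z hZ => Or.inl (h3 Z hZ)⟩
    · obtain ⟨E, h1, h2, h3⟩ := ih h
      obtain ⟨E', h1', h2', h3'⟩ := M.hop_local hz
      refine ⟨E ∪ E', (Finset.card_union_le _ _).trans (by omega),
        Finset.disjoint_union_left.2 ⟨h2, h2'⟩, fun Z hZ => ?_⟩
      rw [Finset.disjoint_union_left] at hZ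
      exact Or.inr ⟨z, h3 Z hZ.1, h3' Z hZ.2⟩

/-- Let `Q` contain all vertices that lose a neighbour by the deletion of `F`. Following a
path of `G` from any vertex to `s`, one reaches `s` or a vertex of `Q` before using a deleted
hop. Hence the deletion of `F` increases distances at most to `(|Q| + 1) * (2 D + 1)`. -/
theorem reachIn_of_reachIn {D : ℕ} (hD : ∀ u ∈ G.verts, ∀ v ∈ G.verts, ReachIn G.Nbr D u v)
    {Q : Finset ℕ} (hQ : ∀ u v, G.Nbr u v → u ∉ M.dead F → ¬ M.Step G F u v → u ∈ Q)
    (hs : s ∈ G.verts) (hsF : s ∉ M.dead F) (h : ReachIn (M.Step G F) t s v) :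
    ReachIn (M.Step G F) ((Q.card + 1) * (2 * D + 1)) s v := by
  have near : ∀ t x, ReachIn G.Nbr t s x → x ∉ M.dead F →
      ∃ p ∈ insert s Q, ReachIn (M.Step G F) t x p := by
    intro t
    induction t with
    | zero => rintro x rfl _; exact ⟨s, Finset.mem_insert_self _ _, rfl⟩
    | succ t ih =>
      rintro x (hx | ⟨z, hz, hzx⟩) hxF
      · obtain ⟨p, hp, h⟩ := ih x hx hxF
        exact ⟨p, hp, Or.inl h⟩
      · by_cases hstep : M.Step G F x z
        · obtain ⟨p, hp, h⟩ := ih z hz (M.notMem_dead_of_hop hstep)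
          exact ⟨p, hp, by rw [Nat.add_comm]; exact (ReachIn.single hstep).trans h⟩
        · exact ⟨x, Finset.mem_insert_of_mem (hQ x z hzx.symm hxF hstep), .refl _ _ _⟩
  refine (ReachIn.of_near_finset (fun _ _ => Step.symm) (Q := insert s Q) (d := D)
    (fun t x hx => ?_) h).mono_right (Nat.mul_le_mul_right _ (Finset.card_insert_le _ _))
  exact near D x (hD s hs x (hx.invariant hs fun _ _ h => h.nbr.right_mem))
    (hx.invariant hsF fun _ _ h => M.notMem_dead_of_hop h)

/-- What a vertex learns from the searches in the members of a family: whether it is separated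
from `s` by `F`. -/
theorem separates_iff {D k L N w : ℕ} {U : Finset α} {Z : ℕ → ℕ → Finset α} {Q : Finset ℕ}
    (hD : ∀ u ∈ G.verts, ∀ v ∈ G.verts, ReachIn G.Nbr D u v)
    (hZU : ∀ g b, Z g b ⊆ U)
    (hZ : ∀ F ⊆ U, ∀ E ⊆ U, F.card ≤ k → E.card ≤ 2 * L → Disjoint F E →
      ∃ g < N, ∃ b < w, F ⊆ Z g b ∧ Disjoint E (Z g b))
    (hQ : ∀ u v, G.Nbr u v → u ∉ M.dead F → ¬ M.Step G F u v → u ∈ Q)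
    (hL : (Q.card + 1) * (2 * D + 1) ≤ L) (hFU : F ⊆ U) (hFk : F.card ≤ k)
    (hs : s ∈ G.verts) :
    M.Separates G F s v ↔ s ∉ M.dead F ∧ v ∉ M.dead F ∧
      ∀ g < N, ∀ b < w, F ⊆ Z g b → ¬ ReachIn (M.Step G (Z g b)) L s v := by
  refine and_congr_right fun hsF => and_congr_right fun _ => ⟨fun h g _ b _ hF hr => ?_,
    fun h t hr => ?_⟩
  · exact h L (hr.mono fun _ _ => M.hop_anti hF)
  · obtain ⟨E, hE, hEF, hEZ⟩ :=
      exists_support ((reachIn_of_reachIn hD hQ hs hsF hr).mono_right hL)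
    obtain ⟨g, hg, b, hb, h1, h2⟩ := hZ F hFU (E ∩ U) Finset.inter_subset_right hFk
      ((Finset.card_le_card Finset.inter_subset_left).trans hE)
      (hEF.symm.mono_right Finset.inter_subset_left)
    refine h g hg b hb h1 (hEZ _ ?_)
    rw [Finset.disjoint_left] at h2 ⊢
    exact fun x hx hxZ => h2 (Finset.mem_inter.2 ⟨hx, hZU g b hxZ⟩) hxZ

end CutModel

/-! ### The protocol -/

/-- The combinatorial data that the nodes agree on beforehand: for each length `L`, a family of
subsets of `U` that serves the cuts of size at most `k` and the paths of length `L`, in groups of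
`w` sets, and a code for the cuts by numbers smaller than `2 ^ w - 1`. -/
structure CutCatalogue {α : Type} [DecidableEq α] (U : Finset α) (k w : ℕ) where
  family : ℕ → ℕ → ℕ → Finset α
  family_subset : ∀ L g b, family L g b ⊆ U
  family_serves : ∀ L, 0 < L → ∀ F ⊆ U, ∀ E ⊆ U, F.card ≤ k → E.card ≤ 2 * L → Disjoint F E →
    ∃ g < groupCount k (2 * L), ∃ b < w, F ⊆ family L g b ∧ Disjoint E (family L g b)
  code : Finset α → ℕ
  decode : ℕ → Finset α
  code_lt : ∀ F ⊆ U, F.card ≤ k → code F < 2 ^ w - 1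
  decode_code : ∀ F ⊆ U, F.card ≤ k → decode (code F) = F

theorem nonempty_cutCatalogue {α : Type} [DecidableEq α] {U : Finset α} {k w : ℕ} (hw : 0 < w)
    (hU : U.card < 2 ^ w) (hcode : (U.card + 1) ^ k < 2 ^ w) :
    Nonempty (CutCatalogue U k w) := by
  have hfam : ∀ L : ℕ, ∃ Z : ℕ → ℕ → Finset α, (∀ g b, Z g b ⊆ U) ∧ (0 < L → ∀ F ⊆ U, ∀ E ⊆ U,
      F.card ≤ k → E.card ≤ 2 * L → Disjoint F E →
        ∃ g < groupCount k (2 * L), ∃ b < w, F ⊆ Z g b ∧ Disjoint E (Z g b)) := by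
    intro L
    rcases Nat.eq_zero_or_pos L with hL | hL
    · exact ⟨fun _ _ => ∅, by simp, fun h => by omega⟩
    · obtain ⟨Z, h1, h2⟩ := exists_grouped_family U (k := k) (l := 2 * L) (by omega) hw hU
      exact ⟨Z, h1, fun _ => h2⟩
  choose Z hZ1 hZ2 using hfam
  set S := U.powerset.filter (·.card ≤ k) with hS
  have hmem : ∀ F ⊆ U, F.card ≤ k → F ∈ S := fun F h1 h2 => by simp [hS, h1, h2]
  have hcard : S.card ≤ (U.card + 1) ^ k := card_filter_powerset_le U k
  refine ⟨⟨Z, hZ1, hZ2, fun F => if h : F ∈ S then S.equivFin ⟨F, h⟩ else 0,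
    fun c => if h : c < S.card then (S.equivFin.symm ⟨c, h⟩ : Finset α) else ∅, ?_, ?_⟩⟩
  · intro F h1 h2
    rw [dif_pos (hmem F h1 h2)]
    have := (S.equivFin ⟨F, hmem F h1 h2⟩).2
    omega
  · intro F h1 h2
    simp [hmem F h1 h2]

section Protocol

variable {α : Type} [DecidableEq α] (M : CutModel α) {U : Finset α} {k w : ℕ}
  (K : CutCatalogue U k w)

open Classical in
/-- The sets of at most `k` elements that separate the node `v` from a source in the list `l`,
according to the results `R` of the searches of length `L`. The number `2 ^ w - 1` may occur in the
list of sources without being a vertex. -/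
noncomputable def localCuts (L v : ℕ) (l : List ℕ) (R : ℕ × ℕ → BitVec w) : Finset (Finset α) :=
  U.powerset.filter fun F => F.card ≤ k ∧ ∃ s ∈ l, s ≠ 2 ^ w - 1 ∧ s ∉ M.dead F ∧ v ∉ M.dead F ∧
    ∀ g < groupCount k (2 * L), ∀ b < w, F ⊆ K.family L g b → ¬ (R (s, g)).getLsbD b = true

/-- The smallest cardinality of a member of `C`, or `k + 1` if `C` has no smaller members. -/
noncomputable def minSize (k : ℕ) (C : Finset (Finset α)) : ℕ :=
  sInf (insert (k + 1) (Finset.card '' (C : Set (Finset α))))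

/-- The smallest code of a member of `C`, or `2 ^ w - 1` if `C` is empty. -/
noncomputable def minCode (C : Finset (Finset α)) : ℕ :=
  sInf (insert (2 ^ w - 1) (K.code '' (C : Set (Finset α))))

/-- The walk length to be searched if distances in the network are at most `D` and the deletion of a
cut affects at most `q` vertices. -/
def searchLength (q D : ℕ) : ℕ := (q + 1) * (2 * D + 1)

/-- The protocol of the node `v` with incident multiplicities `t`, in a network with `n` nodes.
If `Δ` is the maximum degree, the deletion of at most `k` elements deprives at most `q Δ` surviving
vertices of a neighbour. -/
noncomputable def minCutProtocol (q : ℕ → ℕ) (n v : ℕ) (t : ℕ → ℕ) :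
    Protocol (BitVec w) (CutOutput α) :=
  (Protocol.findRadius w v n 0).bind fun d =>
  (Protocol.minFlood w (2 * d) (2 ^ w - 1 - Nat.card {u // t u ≠ 0})).bind fun x =>
  (Protocol.collect w v (2 * d) (k + 1) []).bind fun l =>
  let L := searchLength (q (2 ^ w - 1 - x)) (2 * d)
  (Protocol.forList (fun p : ℕ × ℕ => Protocol.search L
    (fun b u => M.Hop (K.family L p.2 b) (t u) u v) (v = p.1)) (fun _ => 0)
    (l ×ˢ List.range (groupCount k (2 * L)))).bind fun R =>
  let C := localCuts M K L v l R
  (Protocol.minFlood w (2 * d) (minSize k C)).bind fun m =>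
  (Protocol.minFlood w (2 * d) (minCode K (C.filter (·.card = m)))).bind fun c =>
  .halt ⟨if m ≤ k then some (K.decode c) else none, C.filter (·.card = m)⟩

/-- An upper bound for the running time of `minCutProtocol`. -/
def timeBound (k q D : ℕ) : ℕ :=
  (D + 1) * (5 * D + 2) + (2 * D + ((k + 1) * (2 * D) +
    ((k + 1) * groupCount k (2 * searchLength q (2 * D)) * searchLength q (2 * D) +
      (2 * D + 2 * D))))

end Protocol

/-! ### Correctness -/

section MinimumSize

variable {α : Type} {k : ℕ}

theorem minSize_le {C : Finset (Finset α)} {F : Finset α} (h : F ∈ C) : minSize k C ≤ F.card :=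
  Nat.sInf_le (Or.inr ⟨F, h, rfl⟩)

theorem minSize_le_succ (C : Finset (Finset α)) : minSize k C ≤ k + 1 :=
  Nat.sInf_le (Or.inl rfl)

theorem exists_card_eq_minSize {C : Finset (Finset α)} (h : minSize k C ≤ k) :
    ∃ F ∈ C, F.card = minSize k C := by
  rcases Nat.sInf_mem (s := insert (k + 1) (Finset.card '' (C : Set (Finset α))))
    ⟨_, Or.inl rfl⟩ with h' | h'
  · have : minSize k C = k + 1 := h'
    omega
  · exact h'

theorem exists_isMinimumCut {IsCut : Finset α → Prop} {F : Finset α} (hF : IsCut F) :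
    ∃ F₀, IsMinimumCut IsCut F₀ ∧ F₀.card ≤ F.card := by
  classical
  have hex : ∃ n F', IsCut F' ∧ F'.card = n := ⟨_, F, hF, rfl⟩
  obtain ⟨F₀, h1, h2⟩ := Nat.find_spec hex
  have hmin : ∀ F', IsCut F' → F₀.card ≤ F'.card := fun F' h' =>
    h2 ▸ Nat.find_min' hex ⟨F', h', rfl⟩
  exact ⟨F₀, ⟨h1, hmin⟩, hmin F hF⟩

end MinimumSize

section Correctness

variable {α : Type} [DecidableEq α] {M : CutModel α} {U : Finset α} {k w : ℕ}
  {K : CutCatalogue U k w} {G : Network} {IsCut : Finset α → Prop}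

theorem minCode_le {C : Finset (Finset α)} {F : Finset α} (h : F ∈ C) : minCode K C ≤ K.code F :=
  Nat.sInf_le (Or.inr ⟨F, h, rfl⟩)

theorem minCode_le_sub_one (C : Finset (Finset α)) : minCode K C ≤ 2 ^ w - 1 :=
  Nat.sInf_le (Or.inl rfl)

theorem exists_code_eq_minCode {C : Finset (Finset α)} (h : minCode K C < 2 ^ w - 1) :
    ∃ F ∈ C, K.code F = minCode K C := by
  rcases Nat.sInf_mem (s := insert (2 ^ w - 1) (K.code '' (C : Set (Finset α))))
    ⟨_, Or.inl rfl⟩ with h' | h'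
  · have : minCode K C = 2 ^ w - 1 := h'
    omega
  · exact h'

/-- The properties of a notion of cut on `G` that make it an instance of the model `M`: cuts
separate vertices, separating sets contain cuts, and small minimum cuts are subsets of `U`. -/
structure CutModel.Describes (M : CutModel α) (G : Network) (U : Finset α) (k : ℕ)
    (IsCut : Finset α → Prop) : Prop where
  separates_of_isCut : ∀ F, IsCut F → ∃ u ∈ G.verts, ∃ v ∈ G.verts, M.Separates G F u v
  isCut_of_separates : ∀ F, ∀ u ∈ G.verts, ∀ v ∈ G.verts, M.Separates G F u v →
    ∃ F' ⊆ F, IsCut F'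
  subset_of_isMinimumCut : ∀ F, IsMinimumCut IsCut F → F.card ≤ k → F ⊆ U

/-- If the nodes know which sets separate them from the sources, and one of the sources survives
every cut, then the minimum of the sizes of these sets is the size of a minimum cut, and the sets of
this size are exactly the minimum cuts. -/
theorem solvesMinCut_of_local (hM : M.Describes G U k IsCut) {l : List ℕ}
    (hl : ∀ F : Finset α, F.card ≤ k → (∃ v ∈ G.verts, v ∉ M.dead F) →
      ∃ s ∈ l, s ∈ G.verts ∧ s ∉ M.dead F)
    {C : ℕ → Finset (Finset α)}
    (hC : ∀ v ∈ G.verts, ∀ F, F ∈ C v ↔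
      F ⊆ U ∧ F.card ≤ k ∧ ∃ s ∈ l, s ∈ G.verts ∧ M.Separates G F s v)
    {m c : ℕ} (hm : ∃ u ∈ G.verts, m = minSize k (C u)) (hm' : ∀ u ∈ G.verts, m ≤ minSize k (C u))
    (hc : ∃ u ∈ G.verts, c = minCode K ((C u).filter (·.card = m)))
    (hc' : ∀ u ∈ G.verts, c ≤ minCode K ((C u).filter (·.card = m))) :
    SolvesMinCut k G.verts IsCut fun v =>
      ⟨if m ≤ k then some (K.decode c) else none, (C v).filter (·.card = m)⟩ := by
  have hcut : ∀ v ∈ G.verts, ∀ F ∈ C v, ∃ F' ⊆ F, IsCut F' := by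
    intro v hv F hF
    obtain ⟨-, -, s, -, hs, hsep⟩ := (hC v hv F).1 hF
    exact hM.isCut_of_separates F s hs v hv hsep
  have hknown : ∀ F, IsMinimumCut IsCut F → F.card ≤ k → ∃ v ∈ G.verts, F ∈ C v := by
    intro F hF hFk
    obtain ⟨u, hu, v, hv, huF, hvF, huv⟩ := hM.separates_of_isCut F hF.1
    obtain ⟨s, hsl, hs, hsF⟩ := hl F hFk ⟨u, hu, huF⟩
    have hFU := hM.subset_of_isMinimumCut F hF hFk
    by_cases h : ∃ t, ReachIn (M.Step G F) t s u
    · obtain ⟨t, ht⟩ := h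
      refine ⟨v, hv, (hC v hv F).2 ⟨hFU, hFk, s, hsl, hs, hsF, hvF, fun t' ht' => ?_⟩⟩
      exact huv _ ((ht.symm fun _ _ => CutModel.Step.symm).trans ht')
    · exact ⟨u, hu, (hC u hu F).2 ⟨hFU, hFk, s, hsl, hs, hsF, huF, not_exists.1 h⟩⟩
  have hle : ∀ v ∈ G.verts, ∀ F ∈ C v, m ≤ F.card := fun v hv F hF =>
    (hm' v hv).trans (minSize_le hF)
  have hmin : ∀ v ∈ G.verts, ∀ F ∈ C v, F.card = m → IsMinimumCut IsCut F := by
    intro v hv F hF hFm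
    obtain ⟨F', hF'F, hF'⟩ := hcut v hv F hF
    obtain ⟨F₀, hF₀, hle₀⟩ := exists_isMinimumCut hF'
    have hF'c := Finset.card_le_card hF'F
    obtain ⟨v₀, hv₀, hF₀C⟩ := hknown F₀ hF₀ (by have := ((hC v hv F).1 hF).2.1; omega)
    have h0 := hle v₀ hv₀ F₀ hF₀C
    obtain rfl : F' = F := Finset.eq_of_subset_of_card_le hF'F (by omega)
    exact ⟨hF', fun F'' h'' => by have := hF₀.2 F'' h''; omega⟩
  have hsize : ∀ F, IsMinimumCut IsCut F → F.card ≤ k → F.card = m := by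
    intro F hF hFk
    obtain ⟨v, hv, hFC⟩ := hknown F hF hFk
    have h1 := hle v hv F hFC
    obtain ⟨u, hu, hmu⟩ := hm
    obtain ⟨F₁, hF₁, hF₁m⟩ := exists_card_eq_minSize (k := k) (C := C u) (by omega)
    have h2 := hF.2 F₁ (hmin u hu F₁ hF₁ (by omega)).1
    omega
  refine ⟨?_, ?_, ?_, ?_⟩
  · rintro ⟨F, hF, hFk⟩
    obtain ⟨F₀, hF₀, hle₀⟩ := exists_isMinimumCut hF
    obtain ⟨v, hv, hF₀C⟩ := hknown F₀ hF₀ (by omega)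
    have hF₀m := hsize F₀ hF₀ (by omega)
    obtain ⟨u, hu, hcu⟩ := hc
    have h1 := (hc' v hv).trans (minCode_le (Finset.mem_filter.2 ⟨hF₀C, hF₀m⟩))
    have h2 := K.code_lt F₀ ((hC v hv F₀).1 hF₀C).1 (by omega)
    obtain ⟨F₁, hF₁, hF₁c⟩ := exists_code_eq_minCode (K := K)
      (C := (C u).filter (·.card = m)) (by omega)
    rw [Finset.mem_filter] at hF₁
    have hF₁C := (hC u hu F₁).1 hF₁.1
    refine ⟨F₁, hmin u hu F₁ hF₁.1 hF₁.2, fun x _ => ?_⟩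
    simp only
    rw [if_pos (by omega), hcu, ← hF₁c, K.decode_code F₁ hF₁C.1 hF₁C.2.1]
  · intro hno v _
    refine if_neg fun hmk => hno ?_
    obtain ⟨u, hu, hmu⟩ := hm
    obtain ⟨F, hF, hFm⟩ := exists_card_eq_minSize (k := k) (C := C u) (by omega)
    obtain ⟨F', hF'F, hF'⟩ := hcut u hu F hF
    exact ⟨F', hF', (Finset.card_le_card hF'F).trans (by omega)⟩
  · intro v hv F hF
    rw [Finset.mem_filter] at hF
    exact hmin v hv F hF.1 hF.2
  · intro F hF hFk
    obtain ⟨v, hv, hFC⟩ := hknown F hF hFk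
    exact ⟨v, hv, Finset.mem_filter.2 ⟨hFC, hsize F hF hFk⟩⟩

theorem searchLength_mono {q D D' : ℕ} (h : D ≤ D') : searchLength q D ≤ searchLength q D' := by
  unfold searchLength; gcongr

theorem groupCount_mono {l l' : ℕ} (h : l ≤ l') : groupCount k l ≤ groupCount k l' := by
  unfold groupCount; gcongr

/-- The protocol solves the minimum cut problem, if the width `w` of the messages is large enough for
identifiers, degrees and cut sizes. -/
theorem runs_minCutProtocol (hM : M.Describes G U k IsCut) {D Δ : ℕ} {q : ℕ → ℕ}
    (hne : G.verts.Nonempty) (hD : ∀ u ∈ G.verts, ∀ v ∈ G.verts, ReachIn G.Nbr D u v)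
    {n : ℕ} (hn : D < n) (hid : ∀ v ∈ G.verts, v < 2 ^ w - 1) (hk : k + 1 < 2 ^ w)
    (hΔ : ∃ u ∈ G.verts, Nat.card {x // G.mult u x ≠ 0} = Δ)
    (hΔ' : ∀ u ∈ G.verts, Nat.card {x // G.mult u x ≠ 0} ≤ Δ) (hΔw : Δ < 2 ^ w)
    (hq : ∀ F : Finset α, F.card ≤ k → ∃ Q : Finset ℕ, Q.card ≤ q Δ ∧
      ∀ u v, G.Nbr u v → u ∉ M.dead F → ¬ M.Step G F u v → u ∈ Q) :
    ∃ T out, T ≤ timeBound k (q Δ) D ∧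
      G.Runs T (fun v => minCutProtocol M K q n v (G.mult v)) out ∧
      SolvesMinCut k G.verts IsCut out := by
  obtain ⟨d, T₀, hdD, hT₀, hrun₀, hd⟩ := Network.runs_findRadius (w := w)
    (fun v hv => (hid v hv).trans_le (Nat.sub_le _ _)) hD n 0 (Nat.zero_le _) (by omega)
  obtain ⟨x, hrun₁, ⟨u₁, hu₁, hx₁⟩, hx⟩ := Network.runs_minFlood_global (w := w) (T := 2 * d)
    (x := fun v => 2 ^ w - 1 - Nat.card {x // G.mult v x ≠ 0}) (fun v _ => by omega) hne hd
  have hxΔ : 2 ^ w - 1 - x = Δ := by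
    obtain ⟨u, hu, hΔu⟩ := hΔ
    have h1 := hx u hu
    have h2 := hΔ' u₁ hu₁
    omega
  subst hxΔ
  set r := q (2 ^ w - 1 - x)
  obtain ⟨l, hlen, hrun₂, hl, hlmem⟩ := Network.runs_collect hne hid hd (k + 1) [] 0
    (Or.inr (Nat.zero_le _))
  set L := searchLength r (2 * d) with hL
  set N := groupCount k (2 * L) with hN
  have hLpos : 0 < L := by rw [hL, searchLength]; positivity
  obtain ⟨R, hrun₃, hR⟩ := Network.runs_forList (G := G) (T := L)
    (f := fun v (p : ℕ × ℕ) => Protocol.search (w := w) L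
      (fun b u => M.Hop (K.family L p.2 b) (G.mult v u) u v) (v = p.1)) (g := fun _ _ => 0)
    (fun p out => ∀ v, ∀ b < w, (out v).getLsbD b = true ↔
      ReachIn (M.Step G (K.family L p.2 b)) L p.1 v) (l ×ˢ List.range N)
    (fun p _ => Network.runs_search L (fun b u v => M.Step G (K.family L p.2 b) u v)
      (fun _ _ _ h => h.nbr) p.1)
  set C : ℕ → Finset (Finset α) := fun v => localCuts M K L v l (R v) with hCdef
  have hsent : ∀ s ∈ l, (s ≠ 2 ^ w - 1 ↔ s ∈ G.verts) := by
    intro s hs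
    constructor
    · intro h
      simpa [h] using hlmem s hs
    · intro h; exact (hid s h).ne
  have hC : ∀ v ∈ G.verts, ∀ F, F ∈ C v ↔
      F ⊆ U ∧ F.card ≤ k ∧ ∃ s ∈ l, s ∈ G.verts ∧ M.Separates G F s v := by
    intro v hv F
    simp only [hCdef, localCuts, Finset.mem_filter, Finset.mem_powerset]
    refine and_congr_right fun hFU => and_congr_right fun hFk => exists_congr fun s =>
      and_congr_right fun hsl => ?_
    rw [hsent s hsl]
    refine and_congr_right fun hs => ?_
    obtain ⟨Q, hQq, hQ⟩ := hq F hFk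
    rw [CutModel.separates_iff (L := L) hd (K.family_subset L) (K.family_serves L hLpos) hQ
      (by rw [hL, searchLength]; gcongr) hFU hFk hs]
    refine and_congr_right fun _ => and_congr_right fun _ => forall_congr' fun g =>
      forall_congr' fun hg => forall_congr' fun b => forall_congr' fun hb =>
      forall_congr' fun _ => not_congr ?_
    exact hR (s, g) (List.pair_mem_product.2 ⟨hsl, List.mem_range.2 hg⟩) v b hb
  obtain ⟨m, hrun₄, hm, hm'⟩ := Network.runs_minFlood_global (w := w) (T := 2 * d)
    (x := fun v => minSize k (C v)) (fun v _ => (minSize_le_succ _).trans_lt hk) hne hd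
  obtain ⟨c, hrun₅, hc, hc'⟩ := Network.runs_minFlood_global (w := w) (T := 2 * d)
    (x := fun v => minCode K ((C v).filter (·.card = m)))
    (fun v _ => (minCode_le_sub_one _).trans_lt (Nat.sub_lt (Nat.two_pow_pos w) one_pos)) hne hd
  have hsrc : ∀ F : Finset α, F.card ≤ k → (∃ v ∈ G.verts, v ∉ M.dead F) →
      ∃ s ∈ l, s ∈ G.verts ∧ s ∉ M.dead F := by
    rintro F hF ⟨v, hv, hvF⟩
    rcases hl with hl | hl
    · exact ⟨v, hl v hv, hv, hvF⟩
    · obtain ⟨s, hs, hsF⟩ := Finset.exists_mem_notMem_of_card_lt_card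
        (s := M.dead F) (t := G.verts.filter (· ∈ l)) (by have := M.card_dead_le F; omega)
      rw [Finset.mem_filter] at hs
      exact ⟨s, hs.2, hs.1, hsF⟩
  refine ⟨_, _, ?_, hrun₀.bind (hrun₁.bind (hrun₂.bind (hrun₃.bind
    (hrun₄.bind (hrun₅.bind (Network.runs_halt _)))))),
    solvesMinCut_of_local hM hsrc hC hm hm' hc hc'⟩
  have h1 : L ≤ searchLength r (2 * D) := searchLength_mono (by omega)
  have h2 : N ≤ groupCount k (2 * searchLength r (2 * D)) := groupCount_mono (by omega)
  have h3 : (l ×ˢ List.range N).length = (k + 1) * N := by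
    rw [List.length_product, List.length_range, hlen]; simp
  rw [h3, timeBound]
  have h4 : (k + 1) * N * L ≤ (k + 1) * groupCount k (2 * searchLength r (2 * D)) *
    searchLength r (2 * D) := by gcongr
  have h5 : (k + 1) * (2 * d) ≤ (k + 1) * (2 * D) := by gcongr
  rw [Nat.sub_zero] at hT₀
  omega

end Correctness

/-! ### Networks as simple graphs -/

section Graphs

variable {W : Type*} {H : SimpleGraph W} {f : W → ℕ} {R : ℕ → ℕ → Prop}

theorem reachIn_of_walk (hR : ∀ a b, H.Adj a b → R (f a) (f b)) {a b : W} (p : H.Walk a b) :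
    ReachIn R p.length (f a) (f b) := by
  induction p with
  | nil => rfl
  | cons h p ih =>
    rw [SimpleGraph.Walk.length_cons, Nat.add_comm]
    exact (ReachIn.single (hR _ _ h)).trans ih

/-- Reachability in a simple graph on a type embedded into the natural numbers. -/
theorem reachable_iff_exists_reachIn (hf : Function.Injective f)
    (hR : ∀ a b, H.Adj a b ↔ R (f a) (f b)) (hclosed : ∀ a y, R (f a) y → ∃ b, f b = y) {a b : W} :
    H.Reachable a b ↔ ∃ t, ReachIn R t (f a) (f b) := by
  constructor
  · rintro ⟨p⟩
    exact ⟨_, reachIn_of_walk (fun a b => (hR a b).1) p⟩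
  · rintro ⟨t, ht⟩
    have key : ∀ t y, ReachIn R t (f a) y → ∃ b, f b = y ∧ H.Reachable a b := by
      intro t
      induction t with
      | zero => rintro y rfl; exact ⟨a, rfl, .refl _⟩
      | succ t ih =>
        rintro y (h | ⟨z, h, hz⟩)
        · exact ih y h
        · obtain ⟨c, rfl, hc⟩ := ih z h
          obtain ⟨b, rfl⟩ := hclosed c y hz
          exact ⟨b, rfl, hc.trans ((hR c b).2 hz).reachable⟩
    obtain ⟨b', hb', h⟩ := key t _ ht
    rwa [hf hb'] at h

end Graphs

namespace Network

variable {G : Network}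

theorem graph_adj {u v : G.verts} : G.graph.Adj u v ↔ G.Nbr u v := by
  simp only [graph, deleteEdges, Nbr, Finset.notMem_empty, not_false_iff, and_true]
  exact ⟨fun ⟨i, hi⟩ => by omega, fun h => ⟨0, Nat.pos_of_ne_zero h⟩⟩

theorem nonempty_of_connected (h : G.graph.Connected) : G.verts.Nonempty := by
  obtain ⟨v⟩ := h.nonempty
  exact ⟨v, v.2⟩

theorem reachIn_diam (h : G.graph.Connected) :
    ∀ u ∈ G.verts, ∀ v ∈ G.verts, ReachIn G.Nbr G.diam u v := by
  intro u hu v hv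
  have := h.nonempty
  obtain ⟨p, hp⟩ := h.exists_walk_length_eq_dist ⟨u, hu⟩ ⟨v, hv⟩
  have hr := reachIn_of_walk (R := G.Nbr) (f := ((↑) : G.verts → ℕ)) (fun _ _ => graph_adj.1) p
  exact hr.mono_right (hp ▸ SimpleGraph.dist_le_diam (SimpleGraph.connected_iff_ediam_ne_top.1 h))

theorem diam_lt_size (h : G.graph.Connected) : G.diam < G.size := by
  have := h.nonempty
  obtain ⟨u, v, huv⟩ := G.graph.exists_dist_eq_diam
  obtain ⟨p, hp⟩ := (h u v).exists_isPath
  calc G.diam = G.graph.dist u v := huv.symm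
    _ ≤ p.length := SimpleGraph.dist_le p
    _ < Fintype.card G.verts := hp.length_lt
    _ = G.size := Fintype.card_coe _

theorem card_nbr_eq_degree (v : G.verts) [Fintype (G.graph.neighborSet v)] :
    Nat.card {x // G.mult v x ≠ 0} = G.graph.degree v := by
  rw [← SimpleGraph.card_neighborSet_eq_degree, ← Nat.card_eq_fintype_card]
  refine Nat.card_congr ⟨fun x => ⟨⟨x, Nbr.right_mem x.2⟩, graph_adj.2 x.2⟩,
    fun y => ⟨y.1, graph_adj.1 y.2⟩, fun _ => rfl, fun _ => rfl⟩

theorem card_nbr_le_maxDegree {v : ℕ} (hv : v ∈ G.verts) :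
    Nat.card {x // G.mult v x ≠ 0} ≤ G.maxDegree := by
  let _ : DecidableRel G.graph.Adj := Classical.decRel _
  rw [card_nbr_eq_degree ⟨v, hv⟩]
  exact G.graph.degree_le_maxDegree _

theorem exists_card_nbr_eq_maxDegree (h : G.graph.Connected) :
    ∃ v ∈ G.verts, Nat.card {x // G.mult v x ≠ 0} = G.maxDegree := by
  let _ : DecidableRel G.graph.Adj := Classical.decRel _
  have := h.nonempty
  obtain ⟨v, hv⟩ := G.graph.exists_maximal_degree_vertex
  exact ⟨v, v.2, (card_nbr_eq_degree v).trans hv.symm⟩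

theorem maxDegree_lt_size (h : G.graph.Connected) : G.maxDegree < G.size := by
  let _ : DecidableRel G.graph.Adj := Classical.decRel _
  have := h.nonempty
  obtain ⟨v, hv⟩ := G.graph.exists_maximal_degree_vertex
  calc G.maxDegree = G.graph.degree v := hv
    _ < Fintype.card G.verts := G.graph.degree_lt_card_verts v
    _ = G.size := Fintype.card_coe _

theorem maxDegree_eq_zero_iff_diam_eq_zero (h : G.graph.Connected) :
    G.maxDegree = 0 ↔ G.diam = 0 := by
  have hfin : ∀ v, Finite {x // G.mult v x ≠ 0} := fun v =>
    Set.Finite.subset G.verts.finite_toSet fun x (hx : G.mult v x ≠ 0) => Nbr.right_mem hx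
  constructor
  · intro hΔ
    have hno : ∀ u v, ¬ G.Nbr u v := by
      intro u v huv
      have := hfin u
      have h1 := card_nbr_le_maxDegree huv.left_mem
      rw [hΔ, Nat.le_zero, Finite.card_eq_zero_iff] at h1
      exact h1.false ⟨v, huv⟩
    have := h.nonempty
    obtain ⟨u, v, huv⟩ := G.graph.exists_dist_eq_diam
    have heq : (u : ℕ) = v := by
      by_contra hne
      obtain ⟨a, b, hab, -⟩ := (reachIn_diam h u u.2 v v.2).exists_exit (· = (u : ℕ)) rfl
        (Ne.symm hne)
      exact hno a b hab
    rw [diam, ← huv, Subtype.ext heq, SimpleGraph.dist_self]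
  · intro hD
    obtain ⟨v, hv, hΔ⟩ := exists_card_nbr_eq_maxDegree h
    rw [← hΔ, Nat.card_eq_zero]
    left
    refine ⟨fun ⟨x, hx⟩ => hx ?_⟩
    have hvx := reachIn_diam h v hv x (Nbr.right_mem hx)
    rw [hD] at hvx
    obtain rfl : v = x := hvx
    exact G.mult_self v

end Network

/-! ### Edge cuts and vertex cuts -/

/-- The deletion of edges. -/
def edgeModel : CutModel EdgeName where
  Hop Z t u v := ∃ i < t, (s(u, v), i) ∉ Z
  dead _ := ∅
  ne_zero_of_hop := by rintro Z t u v ⟨i, hi, -⟩; omega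
  hop_symm := by rintro Z t u v ⟨i, hi, h⟩; exact ⟨i, hi, by rwa [Sym2.eq_swap]⟩
  hop_anti := by rintro F Z t u v hFZ ⟨i, hi, h⟩; exact ⟨i, hi, fun h' => h (hFZ h')⟩
  notMem_dead_of_hop _ := Finset.notMem_empty _
  hop_local := by
    rintro F t u v ⟨i, hi, h⟩
    exact ⟨{(s(u, v), i)}, by simp, by simpa using h, fun Z hZ => ⟨i, hi, by simpa using hZ⟩⟩
  card_dead_le _ := Nat.zero_le _

/-- The deletion of vertices. -/
def vertexModel : CutModel ℕ where
  Hop Z t u v := t ≠ 0 ∧ u ∉ Z ∧ v ∉ Z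
  dead Z := Z
  ne_zero_of_hop h := h.1
  hop_symm h := ⟨h.1, h.2.2, h.2.1⟩
  hop_anti hFZ h := ⟨h.1, fun h' => h.2.1 (hFZ h'), fun h' => h.2.2 (hFZ h')⟩
  notMem_dead_of_hop h := h.2.2
  hop_local := by
    rintro F t u v ⟨ht, hu, hv⟩
    refine ⟨{u, v}, Finset.card_le_two, by simp [hu, hv], fun Z hZ => ⟨ht, ?_, ?_⟩⟩
    · exact Finset.disjoint_left.1 hZ (by simp)
    · exact Finset.disjoint_left.1 hZ (by simp)
  card_dead_le _ := le_rfl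

section Describes

variable {G : Network}

theorem edgeModel_separates_iff {F : Finset EdgeName} {u v : G.verts} :
    edgeModel.Separates G F u v ↔ ¬ (G.deleteEdges F).Reachable u v := by
  rw [reachable_iff_exists_reachIn (R := edgeModel.Step G F) (f := ((↑) : G.verts → ℕ))
    Subtype.val_injective]
  · simp [CutModel.Separates, edgeModel]
  · intro a b
    simp only [Network.deleteEdges, CutModel.Step, edgeModel, G.mult_comm b a]
  · exact fun a y h => ⟨⟨y, h.nbr.right_mem⟩, rfl⟩

/-- The names of the edges between vertices with identifiers smaller than `m`, up to the `k`-th of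
a family of parallel edges. -/
def edgeNames (m k : ℕ) : Finset EdgeName := (Finset.range m).sym2 ×ˢ Finset.range k

/-- A minimum cut of size at most `k` contains no edge of index `k` or more: such an edge has a
parallel edge outside of the cut, and is therefore superfluous. -/
theorem edgeModel_describes {m k : ℕ} (hm : ∀ v ∈ G.verts, v < m) :
    edgeModel.Describes G (edgeNames m k) k G.IsEdgeCut where
  separates_of_isCut := by
    rintro F ⟨-, hF⟩
    simp only [SimpleGraph.Preconnected, not_forall] at hF
    obtain ⟨u, v, huv⟩ := hF
    exact ⟨u, u.2, v, v.2, edgeModel_separates_iff.2 huv⟩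
  isCut_of_separates := by
    classical
    intro F u hu v hv h
    refine ⟨F.filter G.IsEdge, Finset.filter_subset _ _, fun e he => (Finset.mem_filter.1 he).2,
      fun hpre => (edgeModel_separates_iff (u := ⟨u, hu⟩) (v := ⟨v, hv⟩)).1 h
        ((hpre _ _).mono ?_)⟩
    rintro a b ⟨i, hi, h⟩
    exact ⟨i, hi, fun h' => h (Finset.mem_filter.2 ⟨h', a, b, rfl, hi⟩)⟩
  subset_of_isMinimumCut := by
    intro F hF hFk e he
    obtain ⟨u, v, he1, he2⟩ := hF.1.1 e he
    have hNbr : G.Nbr u v := by unfold Network.Nbr; omega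
    rw [edgeNames, Finset.mem_product, he1, Finset.mk_mem_sym2_iff, Finset.mem_range,
      Finset.mem_range, Finset.mem_range]
    refine ⟨⟨hm u hNbr.left_mem, hm v hNbr.right_mem⟩, ?_⟩
    by_contra! hek
    obtain ⟨j, hj, hjF⟩ : ∃ j < k, (s(u, v), j) ∉ F := by
      by_contra! hall
      have hsub : (Finset.range k).image (fun j => (s(u, v), j)) ⊆ F.erase e := by
        intro x hx
        obtain ⟨j, hj, rfl⟩ := Finset.mem_image.1 hx
        rw [Finset.mem_range] at hj
        refine Finset.mem_erase.2 ⟨?_, hall j hj⟩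
        rintro rfl
        exact absurd hek (by simpa using hj)
      have h1 := Finset.card_le_card hsub
      rw [Finset.card_image_of_injective _ (Prod.mk_right_injective _), Finset.card_range] at h1
      have h2 := Finset.card_erase_lt_of_mem he
      omega
    have hcut : G.IsEdgeCut (F.erase e) := by
      refine ⟨fun x hx => hF.1.1 x (Finset.mem_of_mem_erase hx), fun hpre => hF.1.2 fun a b =>
        (hpre a b).mono ?_⟩
      rintro a b ⟨i, hi, h⟩
      by_cases hie : (s((a : ℕ), (b : ℕ)), i) = e
      · have hab : s((a : ℕ), (b : ℕ)) = s(u, v) := by rw [← he1, ← hie]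
        refine ⟨j, ?_, by rwa [hab]⟩
        have : e.2 = i := by rw [← hie]
        omega
      · exact ⟨i, hi, fun h' => h (Finset.mem_erase.2 ⟨hie, h'⟩)⟩
    have h1 := hF.2 _ hcut
    have h2 := Finset.card_erase_lt_of_mem he
    omega

theorem vertexModel_separates_iff {F : Finset ℕ} {u v : {v : G.verts | (v : ℕ) ∉ F}} :
    vertexModel.Separates G F u.1 v.1 ↔
      ¬ (G.graph.induce {v : G.verts | (v : ℕ) ∉ F}).Reachable u v := by
  rw [reachable_iff_exists_reachIn (R := vertexModel.Step G F)
    (f := fun v : {v : G.verts | (v : ℕ) ∉ F} => (v.1 : ℕ))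
    (Subtype.val_injective.comp Subtype.val_injective)]
  · have hu : (u.1 : ℕ) ∉ F := u.2
    have hv : (v.1 : ℕ) ∉ F := v.2
    simp [CutModel.Separates, vertexModel, hu, hv]
  · intro a b
    have ha : (a.1 : ℕ) ∉ F := a.2
    have hb : (b.1 : ℕ) ∉ F := b.2
    simp [Network.graph_adj, CutModel.Step, vertexModel, ha, hb, Network.Nbr, G.mult_comm b.1 a.1]
  · exact fun a y h => ⟨⟨⟨y, h.nbr.right_mem⟩, h.2.2⟩, rfl⟩

theorem vertexModel_describes {m k : ℕ} (hm : ∀ v ∈ G.verts, v < m) :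
    vertexModel.Describes G (Finset.range m) k G.IsVertexCut where
  separates_of_isCut := by
    rintro F ⟨-, hF⟩
    simp only [SimpleGraph.Preconnected, not_forall] at hF
    obtain ⟨u, v, huv⟩ := hF
    exact ⟨u.1, u.1.2, v.1, v.1.2, vertexModel_separates_iff.2 huv⟩
  isCut_of_separates := by
    intro F u hu v hv h
    refine ⟨F ∩ G.verts, Finset.inter_subset_left, Finset.inter_subset_right, fun hpre => ?_⟩
    have huF : u ∉ F ∩ G.verts := fun h' => h.1 (Finset.mem_inter.1 h').1
    have hvF : v ∉ F ∩ G.verts := fun h' => h.2.1 (Finset.mem_inter.1 h').1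
    refine vertexModel_separates_iff (F := F ∩ G.verts) (u := ⟨⟨u, hu⟩, huF⟩)
      (v := ⟨⟨v, hv⟩, hvF⟩) |>.1 ⟨huF, hvF, fun t ht => h.2.2 t (ht.mono fun a b hab => ?_)⟩
      (hpre _ _)
    have ha := hab.nbr.left_mem
    have hb := hab.nbr.right_mem
    exact ⟨hab.1, fun h' => hab.2.1 (Finset.mem_inter.2 ⟨h', ha⟩),
      fun h' => hab.2.2 (Finset.mem_inter.2 ⟨h', hb⟩)⟩
  subset_of_isMinimumCut := fun F hF _ v hv => Finset.mem_range.2 (hm v (hF.1.1 hv))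

/-- Only the at most `2 k` ends of the edges of `F` can lose a neighbour. -/
theorem exists_edge_portals (G : Network) {k : ℕ} {F : Finset EdgeName} (hF : F.card ≤ k) :
    ∃ Q : Finset ℕ, Q.card ≤ 2 * k ∧
      ∀ u v, G.Nbr u v → u ∉ edgeModel.dead F → ¬ edgeModel.Step G F u v → u ∈ Q := by
  refine ⟨F.biUnion fun e => e.1.toFinset, ?_, fun u v huv _ h => ?_⟩
  · calc _ ≤ F.card * 2 := Finset.card_biUnion_le_card_mul _ _ _ fun e _ => by
          rw [Sym2.card_toFinset]; split_ifs <;> omega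
      _ ≤ 2 * k := by omega
  · refine Finset.mem_biUnion.2 ⟨(s(u, v), 0), ?_, by simp⟩
    by_contra h0
    exact h ⟨0, Nat.pos_of_ne_zero huv.symm, h0⟩

/-- Only the at most `k Δ` neighbours of `F` can lose a neighbour. -/
theorem exists_vertex_portals (G : Network) {k : ℕ} {F : Finset ℕ} (hF : F.card ≤ k) :
    ∃ Q : Finset ℕ, Q.card ≤ k * G.maxDegree ∧
      ∀ u v, G.Nbr u v → u ∉ vertexModel.dead F → ¬ vertexModel.Step G F u v → u ∈ Q := by
  classical
  refine ⟨F.biUnion fun v => G.verts.filter (G.Nbr v), ?_, fun u v huv hu h => ?_⟩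
  · refine (Finset.card_biUnion_le_card_mul _ _ G.maxDegree fun v _ => ?_).trans
      (Nat.mul_le_mul_right _ hF)
    by_cases hv : v ∈ G.verts
    · refine le_trans (le_of_eq (Nat.subtype_card _ fun x => ?_).symm)
        (Network.card_nbr_le_maxDegree hv)
      rw [Finset.mem_filter]
      exact ⟨fun h => h.2, fun h => ⟨Network.Nbr.right_mem h, h⟩⟩
    · rw [Finset.filter_false_of_mem fun x _ hx => hv (Network.Nbr.left_mem hx)]
      exact Nat.zero_le _
  · refine Finset.mem_biUnion.2 ⟨v, ?_, Finset.mem_filter.2 ⟨huv.left_mem, huv.symm⟩⟩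
    by_contra hv
    exact h ⟨huv.symm, hu, hv⟩

end Describes

/-! ### The algorithms -/

section Algorithms

theorem timeBound_mono {k q q' D D' : ℕ} (hq : q ≤ q') (hD : D ≤ D') :
    timeBound k q D ≤ timeBound k q' D' := by
  unfold timeBound groupCount searchLength; gcongr

/-- The time bound is a polynomial in `D`, also if the number of affected vertices is linear in `D`. -/
theorem exists_polynomial_timeBound (k a b : ℕ) :
    ∃ p : Polynomial ℕ, ∀ D, p.eval D = timeBound k (a + b * D) D := by
  let X : Polynomial ℕ := Polynomial.X
  let L : Polynomial ℕ := ((a : Polynomial ℕ) + b * X + 1) * (2 * (2 * X) + 1)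
  let N : Polynomial ℕ := 2 * (2 * (2 * L)) ^ k * ((k : Polynomial ℕ) + 2 * L + 1)
  refine ⟨(X + 1) * (5 * X + 2) + (2 * X + (((k : Polynomial ℕ) + 1) * (2 * X) +
    (((k : Polynomial ℕ) + 1) * N * L + (2 * X + 2 * X)))), fun D => ?_⟩
  simp [X, L, N, timeBound, groupCount, searchLength]

/-- For a notion of cut that is described by a cut model on networks with identifiers smaller than
`n ^ a`, and a universe of deletable elements of size polynomial in `n`, small minimum cuts can be
computed in the `CONGEST` model. -/
theorem exists_congestAlgorithm {α : Type} [DecidableEq α] (M : CutModel α) (k : ℕ) (q : ℕ → ℕ)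
    (U : ℕ → Finset α) {a e : ℕ} (hae : a ≤ e)
    (hU : ∀ n, (U n).card + 1 ≤ 2 ^ (e * (Nat.log 2 n + 1)))
    (IsCut : Network → Finset α → Prop)
    (hM : ∀ G : Network, (∀ v ∈ G.verts, v < G.size ^ a) → M.Describes G (U G.size) k (IsCut G))
    (hq : ∀ (G : Network) (F : Finset α), F.card ≤ k → ∃ Q : Finset ℕ, Q.card ≤ q G.maxDegree ∧
      ∀ u v, G.Nbr u v → u ∉ M.dead F → ¬ M.Step G F u v → u ∈ Q) :
    ∃ (c : ℕ) (A : CongestAlgorithm c (CutOutput α)), ∀ G : Network, G.graph.Connected →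
      (∀ v ∈ G.verts, v < G.size ^ a) → ∀ T, timeBound k (q G.maxDegree) G.diam ≤ T →
        ∃ out : ℕ → CutOutput α, (A G.size).Outputs G T out ∧
          SolvesMinCut k G.verts (IsCut G) out := by
  -- Messages are wide enough for the codes of all sets of `k + 1` elements of `U n`.
  set c := (e + 1) * (k + 1) with hc
  have hwidth : ∀ n, e * (Nat.log 2 n + 1) * (k + 1) < c * (Nat.log 2 n + 1) := by
    intro n
    calc _ = e * ((k + 1) * (Nat.log 2 n + 1)) := by ring
      _ < (e + 1) * ((k + 1) * (Nat.log 2 n + 1)) :=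
        Nat.mul_lt_mul_of_pos_right (Nat.lt_succ_self e) (by positivity)
      _ = _ := by rw [hc]; ring
  have hcode : ∀ n, ((U n).card + 1) ^ (k + 1) < 2 ^ (c * (Nat.log 2 n + 1)) := by
    intro n
    calc _ ≤ (2 ^ (e * (Nat.log 2 n + 1))) ^ (k + 1) := Nat.pow_le_pow_left (hU n) _
      _ = 2 ^ (e * (Nat.log 2 n + 1) * (k + 1)) := (pow_mul _ _ _).symm
      _ < _ := Nat.pow_lt_pow_right (by norm_num) (hwidth n)
  have hK : ∀ n, Nonempty (CutCatalogue (U n) k (c * (Nat.log 2 n + 1))) := fun n =>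
    nonempty_cutCatalogue ((Nat.zero_le _).trans_lt (hwidth n))
      ((Nat.lt_succ_self _).trans_le (Nat.le_self_pow (Nat.succ_ne_zero k) _) |>.trans (hcode n))
      ((Nat.pow_le_pow_right (Nat.succ_pos _) (Nat.le_succ k)).trans_lt (hcode n))
  refine ⟨c, fun n => Protocol.toProgram (minCutProtocol M (hK n).some q n),
    fun G hG hid T hT => ?_⟩
  set b := Nat.log 2 G.size + 1 with hb
  have hsize : G.size < 2 ^ b := Nat.lt_pow_succ_log_self (by norm_num) _
  have hpow : ∀ i ≤ c, 2 ^ (i * b) ≤ 2 ^ (c * b) := fun i hi =>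
    Nat.pow_le_pow_right (by norm_num) (Nat.mul_le_mul_right b hi)
  have hk1 : k + 1 ≤ c := Nat.le_mul_of_pos_left _ (Nat.succ_pos e)
  have he1 : e + 1 ≤ c := Nat.le_mul_of_pos_right _ (Nat.succ_pos k)
  have hidw : ∀ v ∈ G.verts, v < 2 ^ (c * b) - 1 := by
    intro v hv
    have h1 : G.size ^ a ≤ 2 ^ (e * b) := by
      calc G.size ^ a ≤ (2 ^ b) ^ a := Nat.pow_le_pow_left hsize.le _
        _ = 2 ^ (a * b) := by rw [← pow_mul, Nat.mul_comm]
        _ ≤ _ := Nat.pow_le_pow_right (by norm_num) (Nat.mul_le_mul_right b hae)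
    have h2 : 2 ^ (e * b) < 2 ^ (c * b) :=
      Nat.pow_lt_pow_right (by norm_num) (Nat.mul_lt_mul_of_pos_right he1 (Nat.succ_pos _))
    have h3 := hid v hv
    omega
  have hkw : k + 1 < 2 ^ (c * b) :=
    calc k + 1 < 2 ^ (k + 1) := Nat.lt_two_pow_self
      _ ≤ 2 ^ ((k + 1) * b) :=
        Nat.pow_le_pow_right (by norm_num) (Nat.le_mul_of_pos_right _ (Nat.succ_pos _))
      _ ≤ _ := hpow _ hk1
  have hΔw : G.maxDegree < 2 ^ (c * b) :=
    calc G.maxDegree < 2 ^ (1 * b) := by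
          rw [Nat.one_mul]; exact (Network.maxDegree_lt_size hG).trans hsize
      _ ≤ _ := hpow 1 (by omega)
  obtain ⟨T₀, out, hT₀, hrun, hout⟩ := runs_minCutProtocol (K := (hK G.size).some) (q := q)
    (hM G hid) (Network.nonempty_of_connected hG) (Network.reachIn_diam hG)
    (Network.diam_lt_size hG) hidw hkw (Network.exists_card_nbr_eq_maxDegree hG)
    (fun u hu => Network.card_nbr_le_maxDegree hu) hΔw (hq G)
  exact ⟨out, hrun.outputs (hT₀.trans hT), hout⟩

theorem pow_le_two_pow_log (n a : ℕ) : n ^ a ≤ 2 ^ (a * (Nat.log 2 n + 1)) := by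
  calc n ^ a ≤ (2 ^ (Nat.log 2 n + 1)) ^ a :=
        Nat.pow_le_pow_left (Nat.lt_pow_succ_log_self (by norm_num) _).le _
    _ = _ := by rw [← pow_mul, Nat.mul_comm]

theorem card_edgeNames_le (m k : ℕ) : (edgeNames m k).card ≤ m ^ 2 * k := by
  rw [edgeNames, Finset.card_product, Finset.card_sym2, Finset.card_range, Finset.card_range]
  refine Nat.mul_le_mul_right _ ?_
  rw [Nat.choose_two_right, Nat.add_sub_cancel]
  refine Nat.div_le_of_le_mul ?_
  rcases Nat.eq_zero_or_pos m with rfl | hm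
  · simp
  · nlinarith

end Algorithms

theorem theorem2 (k : ℕ) :
    (∃ p : Polynomial ℕ, ∀ a : ℕ, ∃ (c : ℕ) (A : CongestAlgorithm c (CutOutput EdgeName)),
      ∀ G : Network, G.graph.Connected → (∀ v ∈ G.verts, v < G.size ^ a) →
        ∃ out : ℕ → CutOutput EdgeName,
          (A G.size).Outputs G (p.eval G.diam) out ∧
          SolvesMinCut k G.verts G.IsEdgeCut out) ∧
    (∃ p : Polynomial ℕ, ∀ a : ℕ, ∃ (c : ℕ) (A : CongestAlgorithm c (CutOutput ℕ)),
      ∀ G : Network, G.graph.Connected → (∀ v ∈ G.verts, v < G.size ^ a) →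
        ∃ out : ℕ → CutOutput ℕ,
          (A G.size).Outputs G (p.eval (G.diam * G.maxDegree)) out ∧
          SolvesMinCut k G.verts G.IsVertexCut out) := by
  constructor
  · obtain ⟨p, hp⟩ := exists_polynomial_timeBound k (2 * k) 0
    refine ⟨p, fun a => ?_⟩
    obtain ⟨c, A, hA⟩ := exists_congestAlgorithm edgeModel k (fun _ => 2 * k)
      (fun n => edgeNames (n ^ a) k) (a := a) (e := 2 * a + k + 1) (by omega)
      (fun n => by
        have h1 := card_edgeNames_le (n ^ a) k
        have h2 := pow_le_two_pow_log n (2 * a)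
        set b := Nat.log 2 n + 1
        have h3 : k ≤ 2 ^ (k * b) := Nat.lt_two_pow_self.le.trans
          (Nat.pow_le_pow_right (by norm_num) (Nat.le_mul_of_pos_right _ (Nat.succ_pos _)))
        have h4 : 2 ^ 1 ≤ 2 ^ b := Nat.pow_le_pow_right (by norm_num) (Nat.succ_pos _)
        have h5 : (n ^ a) ^ 2 * k ≤ 2 ^ (2 * a * b) * 2 ^ (k * b) := by
          rw [← pow_mul, Nat.mul_comm a 2]
          exact Nat.mul_le_mul h2 h3
        have h6 : 0 < 2 ^ (2 * a * b) * 2 ^ (k * b) := by positivity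
        calc _ ≤ 2 ^ (2 * a * b) * 2 ^ (k * b) * 2 ^ 1 := by omega
          _ ≤ 2 ^ (2 * a * b) * 2 ^ (k * b) * 2 ^ b := Nat.mul_le_mul_left _ h4
          _ = _ := by rw [← pow_add, ← pow_add]; congr 1; ring)
      Network.IsEdgeCut (fun G hid => edgeModel_describes hid)
      (fun G F hF => exists_edge_portals G hF)
    exact ⟨c, A, fun G hG hid => hA G hG hid _ (by rw [hp, Nat.zero_mul, Nat.add_zero])⟩
  · obtain ⟨p, hp⟩ := exists_polynomial_timeBound k 0 k
    refine ⟨p, fun a => ?_⟩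
    obtain ⟨c, A, hA⟩ := exists_congestAlgorithm vertexModel k (fun Δ => k * Δ)
      (fun n => Finset.range (n ^ a)) (a := a) (e := a + 1) (by omega)
      (fun n => by
        have h2 := pow_le_two_pow_log n a
        set b := Nat.log 2 n + 1
        have h4 : 2 ^ 1 ≤ 2 ^ b := Nat.pow_le_pow_right (by norm_num) (Nat.succ_pos _)
        have h6 : 0 < 2 ^ (a * b) := by positivity
        rw [Finset.card_range]
        calc _ ≤ 2 ^ (a * b) * 2 ^ 1 := by omega
          _ ≤ 2 ^ (a * b) * 2 ^ b := Nat.mul_le_mul_left _ h4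
          _ = _ := by rw [← pow_add]; congr 1; ring)
      Network.IsVertexCut (fun G hid => vertexModel_describes hid)
      (fun G F hF => exists_vertex_portals G hF)
    refine ⟨c, A, fun G hG hid => hA G hG hid _ ?_⟩
    rw [hp, Nat.zero_add]
    have h := Network.maxDegree_eq_zero_iff_diam_eq_zero hG
    -- The diameter and the maximum degree vanish simultaneously, so neither exceeds the product.
    refine timeBound_mono (Nat.mul_le_mul_left _ ?_) ?_
    · rcases Nat.eq_zero_or_pos G.diam with h0 | h0
      · rw [h.2 h0]; exact Nat.zero_le _
      · exact Nat.le_mul_of_pos_left _ h0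
    · rcases Nat.eq_zero_or_pos G.maxDegree with h0 | h0
      · rw [h.1 h0]; exact Nat.zero_le _
      · exact Nat.le_mul_of_pos_right _ h0
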